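/- Define rational numbers $B(d_1,\dots,d_n)$ ($n\ge1$, $d_j\ge0$) recursively by $B(0)=\frac18$ and $$B(d,d_1,\dots,d_n)=\sum_{i=1}^n(2d_i+1)\,B(d_1,\dots,d_i+d,\dots,d_n)+\frac12\sum_{\substack{a+b=d-1\\a,b\ge0}}\Bigl(B(a,b,d_1,\dots,d_n)+\sum_{I\sqcup J=\{1,\dots,n\}}B(a,d_I)\,B(b,d_J)\Bigr)$$ for $n\ge0$, $d\ge0$, $(d,d_1,\dots,d_n)\ne(0)$. The Brézin–Gross–Witten (BGW) numbers are $\langle\tau_{d_1}\cdots\tau_{d_n}\rangle^\Theta_g=B(d_1,\dots,d_n)/\prod_j(2d_j+1)!!$, where $g=d_1+\dots+d_n+1$. The normalized BGW numbers are $$C(d_1,\dots,d_n)=\frac{2^{2g-1}\prod_{j=1}^n(2d_j+1)!!}{(X-1)!}\,\langle\tau_{d_1}\cdots\tau_{d_n}\rangle^\Theta_g,\qquad X=X(d_1,\dots,d_n)=\sum_{j=1}^n(2d_j+1)=2g-2+n.$$ Let $n\ge1$ and let $\lambda=(\lambda_1,\dots,\lambda_{n-1})$ be a fixed tuple of positive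 integers, $|\lambda|=\sum_j\lambda_j$. There are polynomials $P_\lambda,Q_\lambda,\widetilde Q_\lambda$ in one variable with coefficients in $\mathbb Z[1/2]$, with $P_\lambda$ monic and $Q_\lambda(g)=P_\lambda(2g-2+n)$, such that the following hold. 1. If $n\ge2$, then $P_\lambda$ has degree $\sum_{j=1}^{n-1}(2\lambda_j+1)+\delta_{n,2}-2$, and for every integer $d_n\ge0$, with $X=X(\lambda,d_n)$, $$C(\lambda,d_n)=\frac{1}{X^{\delta_{n,2}}\,(X-1)!}\;\frac{(2d_n+1)!!^3}{2^{d_n+1}\,d_n!}\;P_\lambda(X).$$ 2. For every integer $g\ge|\lambda|+1$ one has $C(g-1)\ne0$ and $$\frac{C(\lambda,g-1-|\lambda|)}{C(g-1)}=\frac{Q_\lambda(g)}{\prod_{j=1}^{n-3}(2g+j)}\prod_{i=1}^{|\lambda|}\frac{2g-2i}{(2g-2i+1)^3},$$ where $\prod_{j=1}^{n-3}$ is $1$ for $n\le3$. 3. For every integer $g\ge|\lambda|+2$, $$\frac{C(\lambda,g-1-|\lambda|)}{C(g-1)}=\frac{\widetilde Q_\lambda(g)}{(2g-2|\lambda|-2)_{2|\lambda|+n}\,\prod_{i=1}^{|\lambda|}(2g-2i+1)^2},$$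 where $(a)_b=a(a+1)\cdots(a+b-1)$. -/

import Mathlib

open scoped Nat

namespace BGW

/-- `X(d₁,…,dₙ) = ∑ⱼ (2dⱼ+1)`. -/
def X (ds : List ℕ) : ℕ := (ds.map fun d => 2 * d + 1).sum

/-- The genus `g(d₁,…,dₙ) = d₁+⋯+dₙ+1`. -/
def genus (ds : List ℕ) : ℕ := ds.sum + 1

/-- For a tuple `ds = (d₁,…,dₙ)` and a set of indices `I`, the subtuple `(dᵢ)_{i ∈ I}`
(in the order inherited from `ds`). -/
def restrict (ds : List ℕ) (I : Finset (Fin ds.length)) : List ℕ :=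
  ((List.finRange ds.length).filter fun i => i ∈ I).map ds.get

theorem X_cons (d : ℕ) (ds : List ℕ) : X (d :: ds) = 2 * d + 1 + X ds := by
  simp [X]

theorem X_restrict_le (ds : List ℕ) (I : Finset (Fin ds.length)) : X (restrict ds I) ≤ X ds := by
  have h : (restrict ds I).Sublist ds := by
    have h1 := (List.filter_sublist (p := fun i => decide (i ∈ I))
      (l := List.finRange ds.length)).map ds.get
    rwa [List.map_get_finRange] at h1
  exact (h.map fun d => 2 * d + 1).sum_le_sum (by simp)

theorem X_set (d : ℕ) (ds : List ℕ) (i : Fin ds.length) :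
    X (ds.set i (ds.get i + d)) = X ds + 2 * d := by
  induction ds with
  | nil => exact i.elim0
  | cons e es ih =>
    refine Fin.cases ?_ (fun j => ?_) i
    · simp [X_cons]; ring
    · have := ih j
      simp only [List.get_eq_getElem] at this
      simp [X_cons, this]; ring

/-- The numbers `B(d₁,…,dₙ)`, `n ≥ 1`, defined by `B(0) = 1/8` and the
Dijkgraaf–Verlinde–Verlinde-type relation (equivalent to the Virasoro constraints)
`B(d, d₁,…,dₙ) = ∑ᵢ (2dᵢ+1) B(d₁,…,dᵢ+d,…,dₙ)
  + ½ ∑_{a+b=d-1} ( B(a,b,d₁,…,dₙ) + ∑_{I ⊔ J = {1,…,n}} B(a,d_I) B(b,d_J) )`,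
by recursion on `X`. The value `0` at the empty tuple is a convention and is never used. -/
def B : List ℕ → ℚ
  | [] => 0
  | [0] => 1 / 8
  | d :: ds =>
      ∑ i : Fin ds.length, (2 * (ds.get i : ℚ) + 1) * B (ds.set i (ds.get i + d))
      + 1 / 2 * ∑ a : Fin d,
          (B ((a : ℕ) :: (d - 1 - a) :: ds)
            + ∑ I : Finset (Fin ds.length),
                B ((a : ℕ) :: restrict ds I) * B ((d - 1 - a) :: restrict ds Iᶜ))
termination_by ds => X ds
decreasing_by
  · rw [X_set, X_cons]; omega
  · simp only [X_cons]; omega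
  · have := X_restrict_le ds I
    simp only [X_cons]; omega
  · have := X_restrict_le ds Iᶜ
    simp only [X_cons]; omega

/-- The Brézin–Gross–Witten number `⟨τ_{d₁} ⋯ τ_{dₙ}⟩^Θ_g`, `g = d₁+⋯+dₙ+1`, which is
`B(d₁,…,dₙ) / ∏ⱼ (2dⱼ+1)!!`. -/
def number (ds : List ℕ) : ℚ := B ds / (ds.map fun d => ((2 * d + 1)‼ : ℚ)).prod

/-- The normalized BGW number
`C(d₁,…,dₙ) = 2^{2g-1} ∏ⱼ (2dⱼ+1)!! / (X-1)! · ⟨τ_{d₁} ⋯ τ_{dₙ}⟩^Θ_g`. -/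
def C (ds : List ℕ) : ℚ :=
  2 ^ (2 * genus ds - 1) * (ds.map fun d => ((2 * d + 1)‼ : ℚ)).prod / ((X ds - 1)! : ℚ)
    * number ds

/-- The ring `ℤ[1/2]`, as a subring of `ℚ`. -/
abbrev ZHalf : Subalgebra ℤ ℚ := Algebra.adjoin ℤ {(1 / 2 : ℚ)}

end BGW

/-! The operators on the right-hand side of the recursion close under commutation, as in the
Virasoro algebra, so the system `∂_d Z = V_d Z` is integrable. The coefficients of `F = log Z`
satisfy the recursion that defines `B`; hence `B` is symmetric, and any entry can serve as the
variable.

The one-point numbers have a closed form. The derivative `∂_d F` extends to negative `d` by the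
unstable terms `(2k+1) tₖ - δ_{k,0}`, and the extension still satisfies the recursion. Expanding the
recursion in the fixed entries, one finds that the numbers are `(2d+1)!!³ / (d+K)!`, up to powers of
`2`, times a polynomial in `2d`. For negative `d` only unstable values survive, so the polynomial is
divisible by the `K` surplus factors of `(d+K)!`. Following the leading coefficient through the
recursion shows that the quotient is monic. -/

namespace BGW

section ExponentialCoefficients

open MvPowerSeries (pderiv constantCoeff)

variable {σ K : Type*} [DecidableEq σ] [Field K] [CharZero K]

/-- The product of the factorials of the multiplicities of a multiset. -/
noncomputable def multFactorial (S : Multiset σ) : ℕ := S.toFinsupp.prod fun _ k => k !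

theorem multFactorial_cons (d : σ) (S : Multiset σ) :
    multFactorial (d ::ₘ S) = (S.count d + 1) * multFactorial S := by
  classical
  have expand (T : Multiset σ) (hT : T ⊆ d ::ₘ S) :
      multFactorial T = ∏ i ∈ (d ::ₘ S).toFinset, (T.count i)! :=
    Finsupp.prod_of_support_subset _ (by simpa using Multiset.toFinset_subset.mpr hT) _ (by simp)
  have hd : d ∈ (d ::ₘ S).toFinset := by simp
  rw [expand _ (Multiset.Subset.refl _), expand S (Multiset.subset_cons S d),
    ← Finset.mul_prod_erase _ _ hd, ← Finset.mul_prod_erase _ _ hd, Multiset.count_cons_self,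
    Nat.factorial_succ, mul_assoc]
  congr 2
  refine Finset.prod_congr rfl fun i hi => ?_
  rw [Multiset.count_cons_of_ne (Finset.ne_of_mem_erase hi)]

theorem multFactorial_ne_zero (S : Multiset σ) : (multFactorial S : K) ≠ 0 :=
  Nat.cast_ne_zero.mpr (Finset.prod_ne_zero_iff.mpr fun _ _ => Nat.factorial_ne_zero _)

/-- The exponential coefficients of a power series `f` in variables indexed by `σ`: the multiset
`{d₁, …, dₙ}` is sent to the value at `0` of `∂ⁿf / ∂t_{d₁} ⋯ ∂t_{dₙ}`. -/
noncomputable def expCoeff : MvPowerSeries σ K ≃ₗ[K] (Multiset σ → K) where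
  toFun f S := multFactorial S * MvPowerSeries.coeff S.toFinsupp f
  invFun F m := F (Finsupp.toMultiset m) / multFactorial (Finsupp.toMultiset m)
  map_add' f g := by ext S; simp [mul_add]
  map_smul' c f := by ext S; simp [mul_left_comm]
  left_inv f := by
    funext m
    simp only [Finsupp.toMultiset_toFinsupp]
    exact mul_div_cancel_left₀ (f m) (multFactorial_ne_zero _)
  right_inv F := by
    funext S
    change multFactorial S * (F (Finsupp.toMultiset S.toFinsupp) /
      multFactorial (Finsupp.toMultiset S.toFinsupp)) = F S
    rw [Multiset.toFinsupp_toMultiset, mul_div_cancel₀ _ (multFactorial_ne_zero S)]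

theorem expCoeff_apply (f : MvPowerSeries σ K) (S : Multiset σ) :
    expCoeff f S = multFactorial S * MvPowerSeries.coeff S.toFinsupp f :=
  rfl

theorem expCoeff_zero (f : MvPowerSeries σ K) : expCoeff f 0 = constantCoeff f := by
  simp [expCoeff_apply, multFactorial]

theorem expCoeff_cons (f : MvPowerSeries σ K) (d : σ) (S : Multiset σ) :
    expCoeff f (d ::ₘ S) = expCoeff (pderiv K d f) S := by
  have degree : (d ::ₘ S).toFinsupp = S.toFinsupp + Finsupp.single d 1 := by
    rw [← Multiset.singleton_add, map_add, Multiset.toFinsupp_singleton, add_comm]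
  rw [expCoeff_apply, expCoeff_apply, multFactorial_cons, MvPowerSeries.coeff_pderiv, degree,
    Multiset.toFinsupp_apply]
  push_cast
  ring

theorem expCoeff_one (S : Multiset σ) :
    expCoeff (1 : MvPowerSeries σ K) S = if S = 0 then 1 else 0 := by
  induction S using Multiset.induction_on with
  | empty => simp [expCoeff_zero]
  | cons d S _ => simp [expCoeff_cons]

theorem expCoeff_mul (f g : MvPowerSeries σ K) (S : Multiset σ) :
    expCoeff (f * g) S =
      (S.antidiagonal.map fun p => expCoeff f p.1 * expCoeff g p.2).sum := by
  induction S using Multiset.induction_on generalizing f g with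
  | empty => simp [expCoeff_zero]
  | cons d S ih =>
    simp [expCoeff_cons, Derivation.leibniz, ih, mul_comm g]

theorem pderiv_comm {σ R : Type*} [CommSemiring R] (a b : σ) (f : MvPowerSeries σ R) :
    pderiv R a (pderiv R b f) = pderiv R b (pderiv R a f) := by
  classical
  ext m
  simp only [MvPowerSeries.coeff_pderiv, Finsupp.add_apply, Finsupp.single_apply, add_right_comm,
    eq_comm (a := a)]
  split_ifs with h
  · rw [h]
  · push_cast
    ring

/-- The infinite sum `∑ₖ tₖ gₖ`, where `tₖ` are the variables. -/
noncomputable def sumVarMul : (σ → MvPowerSeries σ K) →ₗ[K] MvPowerSeries σ K where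
  toFun g := expCoeff.symm fun S => (S.map fun k => expCoeff (g k) (S.erase k)).sum
  map_add' g h := by
    rw [← map_add]
    congr 1
    ext S
    simp
  map_smul' c g := by
    rw [RingHom.id_apply, ← map_smul]
    congr 1
    ext S
    simp [Multiset.sum_map_mul_left]

theorem expCoeff_sumVarMul (g : σ → MvPowerSeries σ K) (S : Multiset σ) :
    expCoeff (sumVarMul g) S = (S.map fun k => expCoeff (g k) (S.erase k)).sum := by
  simp [sumVarMul]

theorem pderiv_sumVarMul (i : σ) (g : σ → MvPowerSeries σ K) :
    pderiv K i (sumVarMul g) = g i + sumVarMul fun k => pderiv K i (g k) := by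
  apply expCoeff.injective
  ext S
  rw [← expCoeff_cons, map_add, Pi.add_apply, expCoeff_sumVarMul, expCoeff_sumVarMul,
    Multiset.map_cons, Multiset.sum_cons, Multiset.erase_cons_head]
  congr 2
  refine Multiset.map_congr rfl fun k hk => ?_
  rw [← expCoeff_cons, Multiset.erase_cons_tail_of_mem hk]

theorem mul_sumVarMul (f : MvPowerSeries σ K) (g : σ → MvPowerSeries σ K) :
    f * sumVarMul g = sumVarMul fun k => f * g k := by
  apply expCoeff.injective
  ext S
  induction S using Multiset.induction_on generalizing f g with
  | empty => simp [expCoeff_sumVarMul, expCoeff_mul]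
  | cons i S ih =>
    have split : (sumVarMul fun k => f * pderiv K i (g k) + g k * pderiv K i f) =
        (sumVarMul fun k => f * pderiv K i (g k)) + sumVarMul fun k => pderiv K i f * g k := by
      simp only [← map_add, Pi.add_def, mul_comm (pderiv K i f)]
    simp only [expCoeff_cons, Derivation.leibniz, pderiv_sumVarMul, smul_eq_mul, split, map_add,
      Pi.add_apply, mul_add, mul_comm (sumVarMul g), ih]
    ring

/-- The candidate solution of `∂_d f = V d f`, `f(0) = c`: its coefficient at `S ≠ 0` is computed
from those of weight less than `w S`, by means of one chosen element `d` of `S`. -/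
noncomputable def integralCoeff (w : Multiset σ → ℕ)
    (V : σ → MvPowerSeries σ K → MvPowerSeries σ K) (c : K) (S : Multiset σ) : K :=
  open Classical in
  if hS : S = 0 then c
  else
    expCoeff (V (Multiset.exists_mem_of_ne_zero hS).choose
      (expCoeff.symm fun T => if _ : w T < w S then integralCoeff w V c T else 0))
      (S.erase (Multiset.exists_mem_of_ne_zero hS).choose)
termination_by w S

/-- A Frobenius integrability criterion: a system `∂_d f = V d f` in which the coefficients of
`V d f` only involve coefficients of `f` of smaller weight is solvable if its mixed derivatives
agree as far as the equations of smaller weight already force them to. -/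
theorem exists_pderiv_eq (w : Multiset σ → ℕ) (V : σ → MvPowerSeries σ K → MvPowerSeries σ K)
    (local_coeff : ∀ d S f f', (∀ T, w T < w (d ::ₘ S) → expCoeff f T = expCoeff f' T) →
      expCoeff (V d f) S = expCoeff (V d f') S)
    (mixed : ∀ a b S f, (∀ d T, w (d ::ₘ T) < w (a ::ₘ b ::ₘ S) →
        expCoeff (pderiv K d f) T = expCoeff (V d f) T) →
      expCoeff (V a f) (b ::ₘ S) = expCoeff (V b f) (a ::ₘ S)) (c : K) :
    ∃ f, constantCoeff f = c ∧ ∀ d, pderiv K d f = V d f := by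
  set f := expCoeff.symm (integralCoeff w V c) with hf
  have coeff_eq (S : Multiset σ) (hS : S ≠ 0) :
      ∃ e ∈ S, expCoeff f S = expCoeff (V e f) (S.erase e) := by
    have he := (Multiset.exists_mem_of_ne_zero hS).choose_spec
    refine ⟨_, he, ?_⟩
    rw [hf, LinearEquiv.apply_symm_apply, integralCoeff, dif_neg hS]
    refine local_coeff _ _ _ _ fun T hT => ?_
    rw [Multiset.cons_erase he] at hT
    simp [hT]
  have eqn (N : ℕ) (d : σ) (S : Multiset σ) (hN : w (d ::ₘ S) = N) :
      expCoeff (pderiv K d f) S = expCoeff (V d f) S := by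
    induction N using Nat.strong_induction_on generalizing d S with
    | _ N ih =>
      obtain ⟨e, he, hfe⟩ := coeff_eq (d ::ₘ S) Multiset.cons_ne_zero
      rw [← expCoeff_cons, hfe]
      obtain rfl | hed := eq_or_ne e d
      · rw [Multiset.erase_cons_head]
      · have heS : e ∈ S := (Multiset.mem_cons.mp he).resolve_left hed
        obtain ⟨U, rfl⟩ := Multiset.exists_cons_of_mem heS
        rw [Multiset.cons_swap, Multiset.erase_cons_head]
        refine mixed e d U f fun a T hT => ih _ ?_ a T rfl
        rwa [Multiset.cons_swap, hN] at hT
  refine ⟨f, ?_, fun d => expCoeff.injective (funext fun S => eqn _ d S rfl)⟩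
  rw [← expCoeff_zero, hf, LinearEquiv.apply_symm_apply, integralCoeff, dif_pos rfl]

theorem exists_logarithm {σ K : Type*} [Field K] [CharZero K] (f : MvPowerSeries σ K) :
    ∃ F, constantCoeff F = 0 ∧ ∀ d, pderiv K d F = f⁻¹ * pderiv K d f := by
  classical
  have closed (a b : σ) : pderiv K a (f⁻¹ * pderiv K b f) = pderiv K b (f⁻¹ * pderiv K a f) := by
    simp only [Derivation.leibniz, MvPowerSeries.pderiv_inv', pderiv_comm a b, smul_eq_mul]
    ring
  refine exists_pderiv_eq (fun _ => 0) (fun d _ => f⁻¹ * pderiv K d f) (fun _ _ _ _ _ => rfl)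
    (fun a b S _ _ => ?_) 0
  rw [expCoeff_cons, expCoeff_cons, closed]

end ExponentialCoefficients

section Cuts

/-- The pairs `(i, j)` with `i + j = d - 1`; there are none for `d = 0`. -/
def cuts : ℕ → Finset (ℕ × ℕ)
  | 0 => ∅
  | d + 1 => Finset.HasAntidiagonal.antidiagonal d

theorem mem_cuts {d : ℕ} {p : ℕ × ℕ} : p ∈ cuts d ↔ p.1 + p.2 + 1 = d := by
  cases d <;> simp [cuts]

variable {M : Type*} [AddCommMonoid M]

theorem sum_cuts_eq_sum_range (d : ℕ) (f : ℕ → ℕ → M) :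
    ∑ p ∈ cuts d, f p.1 p.2 = ∑ i ∈ Finset.range d, f i (d - 1 - i) := by
  cases d with
  | zero => rfl
  | succ d => exact Finset.Nat.sum_antidiagonal_eq_sum_range_succ f d

theorem sum_cuts_swap (d : ℕ) (f : ℕ → ℕ → M) :
    ∑ p ∈ cuts d, f p.2 p.1 = ∑ p ∈ cuts d, f p.1 p.2 := by
  cases d with
  | zero => rfl
  | succ d => exact Finset.Nat.sum_antidiagonal_swap (f := fun p => f p.1 p.2)

theorem sum_cuts_add (a b : ℕ) (f : ℕ → ℕ → M) :
    ∑ p ∈ cuts (a + b), f p.1 p.2 =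
      ∑ p ∈ cuts a, f (p.1 + b) p.2 + ∑ p ∈ cuts b, f p.1 (p.2 + a) := by
  rw [sum_cuts_eq_sum_range, sum_cuts_eq_sum_range a fun i j => f (i + b) j,
    sum_cuts_eq_sum_range b fun i j => f i (j + a), add_comm a b, Finset.sum_range_add, add_comm]
  congr 1 <;> refine Finset.sum_congr rfl fun i hi => ?_ <;> rw [Finset.mem_range] at hi <;>
    congr 1 <;> omega

theorem sum_cuts_weight_sub {M : Type*} [AddCommGroup M] [Module ℚ M] (a b : ℕ) (h : ℕ → ℕ → M)
    (symm : ∀ i j, h i j = h j i) :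
    ∑ p ∈ cuts a, (2 * p.1 + 1 : ℚ) • h (p.1 + b) p.2 -
        ∑ p ∈ cuts b, (2 * p.1 + 1 : ℚ) • h (p.1 + a) p.2 =
      (a - b : ℚ) • ∑ p ∈ cuts (a + b), h p.1 p.2 := by
  set F : ℕ → ℕ → M := fun i j => (2 * ((i : ℚ) - b) + 1) • h i j with hF
  have merge : ∑ p ∈ cuts a, (2 * p.1 + 1 : ℚ) • h (p.1 + b) p.2 -
      ∑ p ∈ cuts b, (2 * p.1 + 1 : ℚ) • h (p.1 + a) p.2 = ∑ p ∈ cuts (a + b), F p.1 p.2 := by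
    rw [sum_cuts_add, ← sum_cuts_swap b fun i j => (2 * i + 1 : ℚ) • h (i + a) j, sub_eq_add_neg,
      ← Finset.sum_neg_distrib]
    refine congrArg₂ _ (Finset.sum_congr rfl fun p _ => ?_) (Finset.sum_congr rfl fun p hp => ?_)
    · simp [hF]
    · simp only [hF]
      rw [symm p.1, ← neg_smul, ← mem_cuts.mp hp]
      congr 1
      push_cast
      ring
  have average (p : ℕ × ℕ) (hp : p ∈ cuts (a + b)) :
      F p.1 p.2 + F p.2 p.1 = (2 : ℚ) • (a - b : ℚ) • h p.1 p.2 := by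
    have hsum : (p.1 + p.2 + 1 : ℚ) = a + b := by exact_mod_cast mem_cuts.mp hp
    simp only [hF]
    rw [symm p.2, ← add_smul, smul_smul]
    congr 1
    linear_combination 2 * hsum
  rw [merge, ← smul_right_inj (two_ne_zero (α := ℚ)), two_smul, Finset.smul_sum, Finset.smul_sum]
  nth_rewrite 2 [← sum_cuts_swap]
  rw [← Finset.sum_add_distrib]
  exact Finset.sum_congr rfl average

end Cuts

section Virasoro

open MvPowerSeries (pderiv constantCoeff)

/-- Formal power series in the variables `t₀, t₁, …`. -/
abbrev Series := MvPowerSeries ℕ ℚ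

/-- The operator `∂ / ∂t_d`. -/
noncomputable def der (d : ℕ) : Module.End ℚ Series := (pderiv ℚ d : Series →ₗ[ℚ] Series)

/-- The operator `∑ₖ (2k+1) tₖ ∂_{k+d}`. -/
noncomputable def shift (d : ℕ) : Module.End ℚ Series :=
  sumVarMul ∘ₗ LinearMap.pi fun k => (2 * k + 1 : ℚ) • der (k + d)

/-- The operator `∑_{i+j=d-1} ∂_i ∂_j`. -/
noncomputable def quad (d : ℕ) : Module.End ℚ Series := ∑ p ∈ cuts d, der p.1 * der p.2

/-- The operator `V_d` in the Virasoro constraints `∂_d Z = V_d Z` of the BGW tau function `Z`. -/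
noncomputable def vir (d : ℕ) : Module.End ℚ Series :=
  shift d + (1 / 2 : ℚ) • quad d + (if d = 0 then 1 / 8 else 0 : ℚ) • 1

theorem expCoeff_der (d : ℕ) (f : Series) (S : Multiset ℕ) :
    expCoeff (der d f) S = expCoeff f (d ::ₘ S) :=
  (expCoeff_cons f d S).symm

theorem expCoeff_shift (d : ℕ) (f : Series) (S : Multiset ℕ) :
    expCoeff (shift d f) S =
      (S.map fun k : ℕ => (2 * k + 1 : ℚ) * expCoeff f ((k + d) ::ₘ S.erase k)).sum := by
  simp [shift, expCoeff_sumVarMul, expCoeff_der]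

theorem expCoeff_vir (d : ℕ) (f : Series) (S : Multiset ℕ) :
    expCoeff (vir d f) S =
      (S.map fun k : ℕ => (2 * k + 1 : ℚ) * expCoeff f ((k + d) ::ₘ S.erase k)).sum +
        1 / 2 * ∑ p ∈ cuts d, expCoeff f (p.1 ::ₘ p.2 ::ₘ S) +
        (if d = 0 then 1 / 8 else 0) * expCoeff f S := by
  simp only [vir, quad, LinearMap.add_apply, LinearMap.smul_apply, LinearMap.sum_apply,
    Module.End.mul_apply, Module.End.one_apply, map_add, map_smul, map_sum, Pi.add_apply,
    Pi.smul_apply, Finset.sum_apply, smul_eq_mul, expCoeff_shift, expCoeff_der,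
    Multiset.cons_swap]

theorem commute_der_der (a b : ℕ) : Commute (der a) (der b) :=
  LinearMap.ext fun f => pderiv_comm a b f

theorem der_mul_shift (c d : ℕ) :
    der c * shift d = shift d * der c + (2 * c + 1 : ℚ) • der (c + d) := by
  ext1 f
  have swap (k : ℕ) : der c (der (k + d) f) = der (k + d) (der c f) := pderiv_comm c (k + d) f
  have pderiv_shift : der c (shift d f) = (2 * c + 1 : ℚ) • der (c + d) f +
      sumVarMul fun k => der c ((2 * k + 1 : ℚ) • der (k + d) f) := pderiv_sumVarMul c _
  simp only [map_smul, swap] at pderiv_shift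
  exact pderiv_shift.trans (add_comm _ _)

theorem constantCoeff_shift (d : ℕ) (f : Series) : constantCoeff (shift d f) = 0 := by
  simp [← expCoeff_zero, expCoeff_shift]

theorem eq_zero_of_commute_der {T : Module.End ℚ Series} (comm : ∀ c, Commute (der c) T)
    (const : ∀ f, constantCoeff (T f) = 0) : T = 0 := by
  ext1 f
  refine expCoeff.injective (funext fun S => ?_)
  induction S using Multiset.induction_on generalizing f with
  | empty => simp [expCoeff_zero, const]
  | cons c S ih =>
    rw [← expCoeff_der, ← Module.End.mul_apply, (comm c).eq, Module.End.mul_apply, ih]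
    simp

theorem shift_mul_shift (a b : ℕ) :
    shift a * shift b = shift b * shift a + (2 * (a - b) : ℚ) • shift (a + b) := by
  rw [← sub_eq_zero]
  refine eq_zero_of_commute_der (fun c => ?_) fun f => by simp [constantCoeff_shift]
  have der_mul (a b : ℕ) : der c * (shift a * shift b) = shift a * shift b * der c +
      (2 * c + 1 : ℚ) • (shift a * der (c + b) + shift b * der (c + a) +
        (2 * (c + a) + 1 : ℚ) • der (c + a + b)) := by
    rw [← mul_assoc, der_mul_shift, add_mul, mul_assoc, der_mul_shift, smul_mul_assoc,
      der_mul_shift, mul_add, mul_assoc, mul_smul_comm]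
    push_cast
    module
  rw [Commute, SemiconjBy, mul_sub, mul_add, mul_smul_comm, der_mul, der_mul, der_mul_shift,
    sub_mul, add_mul, smul_mul_assoc, add_right_comm c b a, add_assoc c a b]
  module

theorem commute_der_quad (c d : ℕ) : Commute (der c) (quad d) :=
  Commute.sum_right _ _ _ fun p _ =>
    (commute_der_der c p.1).mul_right (commute_der_der c p.2)

theorem commute_quad_quad (a b : ℕ) : Commute (quad a) (quad b) :=
  Commute.sum_left _ _ _ fun p _ => (commute_der_quad p.1 b).mul_left (commute_der_quad p.2 b)

theorem quad_mul_shift (b a : ℕ) :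
    quad b * shift a = shift a * quad b +
      (2 : ℚ) • ∑ p ∈ cuts b, (2 * p.1 + 1 : ℚ) • (der (p.1 + a) * der p.2) := by
  have term (i j : ℕ) : der i * der j * shift a = shift a * (der i * der j) +
      ((2 * j + 1 : ℚ) • (der (j + a) * der i) + (2 * i + 1 : ℚ) • (der (i + a) * der j)) := by
    rw [mul_assoc, der_mul_shift, mul_add, ← mul_assoc, der_mul_shift, add_mul, mul_smul_comm,
      smul_mul_assoc, (commute_der_der i (j + a)).eq, mul_assoc]
    module
  simp only [quad, Finset.sum_mul, Finset.mul_sum, term, Finset.sum_add_distrib]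
  rw [two_smul, sum_cuts_swap b fun i j => (2 * i + 1 : ℚ) • (der (i + a) * der j)]

theorem der_mul_vir (c d : ℕ) :
    der c * vir d = vir d * der c + (2 * c + 1 : ℚ) • der (c + d) := by
  simp only [vir, mul_add, add_mul, mul_smul_comm, smul_mul_assoc, der_mul_shift,
    (commute_der_quad c d).eq, mul_one, one_mul]
  abel

theorem vir_mul_vir (a b : ℕ) :
    vir a * vir b = vir b * vir a + (2 * (a - b) : ℚ) • vir (a + b) := by
  have const : (2 * (a - b) : ℚ) * (if a + b = 0 then 1 / 8 else 0) = 0 := by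
    split_ifs with h
    · simp [show a = 0 by omega, show b = 0 by omega]
    · rw [mul_zero]
  have quad_part := sum_cuts_weight_sub a b (fun i j => der i * der j)
    commute_der_der
  rw [← quad] at quad_part
  simp only [vir, mul_add, add_mul, mul_smul_comm, smul_mul_assoc, smul_add, mul_one, one_mul,
    shift_mul_shift a b, quad_mul_shift a b, quad_mul_shift b a, (commute_quad_quad a b).eq]
  rw [smul_smul (2 * (a - b : ℚ)) (ite _ _ _), const, zero_smul, mul_smul (2 : ℚ),
    mul_smul (2 : ℚ), smul_comm _ (1 / 2 : ℚ) (quad (a + b)), ← quad_part]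
  module

/-- The quantity `∑ (2dⱼ+1) = 2g - 2 + n` attached to a correlator of insertions `dⱼ`. -/
def weight (S : Multiset ℕ) : ℕ := (S.map fun d => 2 * d + 1).sum

theorem weight_cons (d : ℕ) (S : Multiset ℕ) : weight (d ::ₘ S) = 2 * d + 1 + weight S := by
  simp [weight]

theorem weight_add (S T : Multiset ℕ) : weight (S + T) = weight S + weight T := by
  simp [weight]

theorem expCoeff_vir_congr (d : ℕ) (S : Multiset ℕ) (f f' : Series)
    (agree : ∀ T, weight T < weight (d ::ₘ S) → expCoeff f T = expCoeff f' T) :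
    expCoeff (vir d f) S = expCoeff (vir d f') S := by
  rw [expCoeff_vir, expCoeff_vir, agree S (by simp [weight_cons])]
  congr 3
  · refine Multiset.map_congr rfl fun k hk => ?_
    obtain ⟨T, rfl⟩ := Multiset.exists_cons_of_mem hk
    rw [Multiset.erase_cons_head, agree _ (by simp only [weight_cons]; omega)]
  · refine Finset.sum_congr rfl fun p hp => ?_
    have := mem_cuts.mp hp
    exact agree _ (by simp only [weight_cons]; omega)

theorem exists_der_eq_vir : ∃ Z : Series, constantCoeff Z = 1 ∧ ∀ d, der d Z = vir d Z := by
  refine exists_pderiv_eq weight (fun d => vir d) expCoeff_vir_congr (fun a b S f hf => ?_) 1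
  replace hf (d : ℕ) (T : Multiset ℕ) (hT : weight (d ::ₘ T) < weight (a ::ₘ b ::ₘ S)) :
      expCoeff (der d f) T = expCoeff (vir d f) T := hf d T hT
  have der_vir (a b : ℕ) (hf : ∀ d T, weight (d ::ₘ T) < weight (a ::ₘ b ::ₘ S) →
      expCoeff (der d f) T = expCoeff (vir d f) T) :
      expCoeff (vir a f) (b ::ₘ S) =
        expCoeff (vir a (vir b f)) S + (2 * b + 1) * expCoeff (vir (a + b) f) S := by
    rw [← expCoeff_vir_congr a S (der b f) (vir b f) fun T hT => hf b T ?_,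
      ← hf (a + b) S (by simp only [weight_cons]; omega), ← expCoeff_der, ← Module.End.mul_apply,
      der_mul_vir, add_comm b a]
    · simp
    · simp only [weight_cons] at hT ⊢
      omega
  have bracket := congrArg (fun A : Module.End ℚ Series => expCoeff (A f) S) (vir_mul_vir a b)
  simp only [Module.End.mul_apply, LinearMap.add_apply, LinearMap.smul_apply, map_add, map_smul,
    Pi.add_apply, Pi.smul_apply, smul_eq_mul] at bracket
  rw [der_vir a b hf, der_vir b a (by simpa only [Multiset.cons_swap a b] using hf), bracket,
    add_comm b a]
  ring

/-- The BGW tau function: the normalized solution of the Virasoro constraints. -/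
noncomputable def tau : Series := exists_der_eq_vir.choose

theorem constantCoeff_tau : constantCoeff tau = 1 := exists_der_eq_vir.choose_spec.1

theorem der_tau (d : ℕ) : der d tau = vir d tau := exists_der_eq_vir.choose_spec.2 d

theorem inv_tau_mul_tau : tau⁻¹ * tau = 1 :=
  MvPowerSeries.inv_mul_cancel _ (by simp [constantCoeff_tau])

/-- The generating series `F = ∑ B(d₁,…,dₙ) t_{d₁} ⋯ t_{dₙ} / n!` of the numbers `B`, constructed
as the logarithm of the tau function. -/
noncomputable def freeEnergy : Series := (exists_logarithm tau).choose

theorem constantCoeff_freeEnergy : constantCoeff freeEnergy = 0 :=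
  (exists_logarithm tau).choose_spec.1

theorem der_tau_eq_mul (d : ℕ) : der d tau = tau * der d freeEnergy := by
  have log : der d freeEnergy = tau⁻¹ * der d tau := (exists_logarithm tau).choose_spec.2 d
  rw [log, ← mul_assoc, mul_comm tau, inv_tau_mul_tau, one_mul]

theorem der_der_tau (i j : ℕ) : der i (der j tau) =
    tau * (der i (der j freeEnergy) + der i freeEnergy * der j freeEnergy) := by
  have leibniz : der i (tau * der j freeEnergy) =
      tau * der i (der j freeEnergy) + der j freeEnergy * der i tau := (pderiv ℚ i).leibniz _ _
  rw [der_tau_eq_mul j, leibniz, der_tau_eq_mul i]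
  ring

theorem shift_tau (d : ℕ) : shift d tau = tau * shift d freeEnergy := by
  have mul_sum : tau * shift d freeEnergy = _ := mul_sumVarMul tau _
  rw [mul_sum]
  change sumVarMul (fun k : ℕ => (2 * k + 1 : ℚ) • der (k + d) tau) =
    sumVarMul (fun k : ℕ => tau * ((2 * k + 1 : ℚ) • der (k + d) freeEnergy))
  simp only [der_tau_eq_mul, mul_smul_comm]

theorem der_freeEnergy (d : ℕ) : der d freeEnergy = shift d freeEnergy +
    (1 / 2 : ℚ) • ∑ p ∈ cuts d, (der p.1 (der p.2 freeEnergy) +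
      der p.1 freeEnergy * der p.2 freeEnergy) + (if d = 0 then 1 / 8 else 0 : ℚ) • 1 := by
  have virasoro := der_tau d
  simp only [vir, quad, LinearMap.add_apply, LinearMap.smul_apply, LinearMap.sum_apply,
    Module.End.mul_apply, Module.End.one_apply, shift_tau, der_der_tau,
    ← Finset.mul_sum] at virasoro
  rw [der_tau_eq_mul] at virasoro
  have cancel := congrArg (tau⁻¹ * ·) virasoro
  simpa only [mul_add, mul_smul_comm, ← mul_assoc, inv_tau_mul_tau, one_mul] using cancel

/-- The coefficients of the free energy; for `S ≠ 0` they are the numbers `B`. -/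
noncomputable def connected (S : Multiset ℕ) : ℚ := expCoeff freeEnergy S

theorem connected_zero : connected 0 = 0 := by
  rw [connected, expCoeff_zero, constantCoeff_freeEnergy]

theorem connected_cons (d : ℕ) (S : Multiset ℕ) :
    connected (d ::ₘ S) =
      (S.map fun k : ℕ => (2 * k + 1 : ℚ) * connected ((k + d) ::ₘ S.erase k)).sum +
      1 / 2 * ∑ p ∈ cuts d, (connected (p.1 ::ₘ p.2 ::ₘ S) +
        (S.antidiagonal.map fun q => connected (p.1 ::ₘ q.1) * connected (p.2 ::ₘ q.2)).sum) +
      if d = 0 ∧ S = 0 then 1 / 8 else 0 := by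
  have key := congrArg (fun f => expCoeff f S) (der_freeEnergy d)
  simp only [map_add, map_smul, map_sum, Pi.add_apply, Pi.smul_apply, Finset.sum_apply,
    smul_eq_mul, expCoeff_der, expCoeff_shift, expCoeff_mul, expCoeff_one,
    Multiset.cons_swap] at key
  rw [ite_zero_mul_ite_zero, mul_one] at key
  exact key

theorem connected_singleton (d : ℕ) : connected {d} = expCoeff tau {d} := by
  rw [connected, ← Multiset.cons_zero, ← expCoeff_der, ← expCoeff_der, der_tau_eq_mul,
    expCoeff_zero, expCoeff_zero, map_mul, constantCoeff_tau, one_mul]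

theorem expCoeff_tau_cons (d : ℕ) (S : Multiset ℕ) :
    expCoeff tau (d ::ₘ S) =
      (S.map fun k : ℕ => (2 * k + 1 : ℚ) * expCoeff tau ((k + d) ::ₘ S.erase k)).sum +
        1 / 2 * ∑ p ∈ cuts d, expCoeff tau (p.1 ::ₘ p.2 ::ₘ S) +
        (if d = 0 then 1 / 8 else 0) * expCoeff tau S := by
  rw [← expCoeff_der, der_tau, expCoeff_vir]

open Finset.HasAntidiagonal (antidiagonal mem_antidiagonal)

theorem sum_antidiagonal_cuts_rotate {M : Type*} [AddCommMonoid M] (n : ℕ) (f : ℕ → ℕ → ℕ → M) :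
    ∑ p ∈ antidiagonal n, ∑ q ∈ cuts p.1, f q.2 p.2 q.1 =
      ∑ p ∈ antidiagonal n, ∑ q ∈ cuts p.1, f q.1 q.2 p.2 := by
  rw [Finset.sum_sigma', Finset.sum_sigma']
  refine Finset.sum_nbij' (fun x => ⟨(x.2.2 + x.1.2 + 1, x.2.1), (x.2.2, x.1.2)⟩)
    (fun x => ⟨(x.1.2 + x.2.1 + 1, x.2.2), (x.1.2, x.2.1)⟩) ?_ ?_ ?_ ?_ ?_
  all_goals
    rintro ⟨⟨d, e⟩, i, j⟩ h
    obtain ⟨hde, hij⟩ : d + e = n ∧ i + j + 1 = d := by simpa [mem_cuts] using h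
    subst hij
  all_goals simp [mem_cuts]; try omega

theorem sum_antidiagonal_cuts_eq_zero (n : ℕ) (f : ℕ → ℕ → ℕ → ℚ)
    (rotate : ∀ i j k, f j k i = f i j k) :
    ∑ p ∈ antidiagonal n, ∑ q ∈ cuts p.1, (3 * p.2 + 1 - n : ℚ) * f q.1 q.2 p.2 = 0 := by
  have first := sum_antidiagonal_cuts_rotate n fun i j k => (3 * k + 1 - n : ℚ) * f i j k
  have second := sum_antidiagonal_cuts_rotate n fun i j k => (3 * i + 1 - n : ℚ) * f j k i
  have total : ∑ p ∈ antidiagonal n, ∑ q ∈ cuts p.1, ((3 * p.2 + 1 - n : ℚ) * f q.1 q.2 p.2 +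
      (3 * q.1 + 1 - n : ℚ) * f q.2 p.2 q.1 + (3 * q.2 + 1 - n : ℚ) * f p.2 q.1 q.2) = 0 := by
    refine Finset.sum_eq_zero fun p hp => Finset.sum_eq_zero fun q hq => ?_
    have sum_eq : (q.1 + q.2 + 1 + p.2 : ℚ) = n := by
      exact_mod_cast (mem_cuts.mp hq).symm ▸ mem_antidiagonal.mp hp
    rw [rotate q.1 q.2, rotate p.2 q.1]
    linear_combination 3 * f p.2 q.1 q.2 * sum_eq
  simp only [Finset.sum_add_distrib] at total
  linarith

theorem two_mul_sum_antidiagonal_snd_mul (n : ℕ) (f : ℕ → ℕ → ℚ) (symm : ∀ i j, f i j = f j i) :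
    2 * ∑ p ∈ antidiagonal n, (p.2 : ℚ) * f p.1 p.2 = n * ∑ p ∈ antidiagonal n, f p.1 p.2 := by
  rw [two_mul]
  nth_rewrite 2 [← Finset.Nat.sum_antidiagonal_swap]
  rw [← Finset.sum_add_distrib, Finset.mul_sum]
  refine Finset.sum_congr rfl fun p hp => ?_
  rw [← mem_antidiagonal.mp hp, Prod.fst_swap, Prod.snd_swap, symm p.2]
  push_cast
  ring

theorem two_mul_sum_antidiagonal_weights (n : ℕ) :
    2 * ∑ p ∈ antidiagonal n, (3 * p.2 + 1 - n : ℚ) * (2 * p.2 + 1) =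
      (n + 1) * (n + 2) * (2 * n + 1) := by
  have power_sums (a : ℚ) : 2 * ∑ p ∈ antidiagonal n, (3 * p.2 + 1 - a) * (2 * p.2 + 1) =
      (n + 1) * (4 * n ^ 2 + 7 * n + 2 - 2 * a * (n + 1)) := by
    induction n with
    | zero => simp; ring
    | succ n ih => rw [Finset.Nat.sum_antidiagonal_succ, mul_add, ih]; push_cast; ring
  rw [power_sums]
  ring

theorem sum_antidiagonal_expCoeff_tau_pair (n : ℕ) (w : ℕ → ℚ) :
    ∑ p ∈ antidiagonal n, w p.2 * expCoeff tau {p.1, p.2} =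
      (∑ p ∈ antidiagonal n, w p.2 * (2 * p.2 + 1)) * expCoeff tau {n} +
        1 / 2 * ∑ p ∈ antidiagonal n, ∑ q ∈ cuts p.1, w p.2 * expCoeff tau {q.1, q.2, p.2} +
        1 / 8 * w n * expCoeff tau {n} := by
  have two_point (d e : ℕ) : expCoeff tau {d, e} = (2 * e + 1) * expCoeff tau {d + e} +
      1 / 2 * ∑ q ∈ cuts d, expCoeff tau {q.1, q.2, e} +
        (if d = 0 then 1 / 8 else 0) * expCoeff tau {e} := by
    simp [expCoeff_tau_cons d, add_comm d]
  have boundary : 1 / 8 * w n * expCoeff tau {n} = ∑ p ∈ antidiagonal n,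
      w p.2 * ((if p.1 = 0 then 1 / 8 else 0) * expCoeff tau {p.2}) := by
    rw [Finset.sum_eq_single_of_mem (0, n) (by simp)]
    · simp only [if_true]
      ring
    · intro p hp hne
      have : p.1 ≠ 0 := fun h => hne (Prod.ext h (by simpa [h] using hp))
      simp [this]
  rw [boundary, Finset.sum_mul, Finset.mul_sum, ← Finset.sum_add_distrib, ← Finset.sum_add_distrib]
  refine Finset.sum_congr rfl fun p hp => ?_
  rw [two_point, mem_antidiagonal.mp hp, ← Finset.mul_sum]
  ring

-- The weight `3e + 1 - n` makes the three-point terms of the two-point relation cancel.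
theorem connected_singleton_succ (n : ℕ) :
    8 * (n + 2 : ℚ) * connected {n + 1} = (2 * n + 3) ^ 2 * (2 * n + 1) * connected {n} := by
  set Z : Multiset ℕ → ℚ := expCoeff tau with hZ
  have one_point : 2 * Z {n + 1} = ∑ p ∈ antidiagonal n, Z {p.1, p.2} := by
    rw [hZ, ← Multiset.cons_zero, expCoeff_tau_cons]
    simp [cuts]
  have cancel := sum_antidiagonal_cuts_eq_zero n (fun i j k => Z {i, j, k})
    fun i j k => congrArg Z (show ({j, k, i} : Multiset ℕ) = {i, j, k} by
      simp only [Multiset.insert_eq_cons, ← Multiset.singleton_add]; abel)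
  have symmetrize := two_mul_sum_antidiagonal_snd_mul n (fun i j => Z {i, j})
    fun i j => congrArg Z (Multiset.cons_swap i j 0)
  have weighted := sum_antidiagonal_expCoeff_tau_pair n fun e => 3 * e + 1 - n
  have expand : ∑ p ∈ antidiagonal n, (3 * p.2 + 1 - n : ℚ) * Z {p.1, p.2} =
      3 * ∑ p ∈ antidiagonal n, (p.2 : ℚ) * Z {p.1, p.2} +
        (1 - n) * ∑ p ∈ antidiagonal n, Z {p.1, p.2} := by
    rw [Finset.mul_sum, Finset.mul_sum, ← Finset.sum_add_distrib]
    exact Finset.sum_congr rfl fun p _ => by ring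
  have weights := two_mul_sum_antidiagonal_weights n
  rw [connected_singleton, connected_singleton]
  linear_combination 4 * (n + 2) * one_point + 4 * Z {n} * weights - 12 * symmetrize +
    8 * weighted - 8 * expand + 4 * cancel

theorem connected_singleton_zero : connected {0} = 1 / 8 := by
  rw [← Multiset.cons_zero, connected_cons]
  simp [cuts]

end Virasoro

section Symmetry

theorem weight_coe (ds : List ℕ) : weight (ds : Multiset ℕ) = X ds := by
  simp [weight, X]

theorem coe_set (ds : List ℕ) (i : Fin ds.length) (e : ℕ) :
    (ds.set i e : Multiset ℕ) = e ::ₘ (ds : Multiset ℕ).erase (ds.get i) := by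
  rw [Multiset.coe_erase, Multiset.cons_coe, Multiset.coe_eq_coe]
  exact (List.set_perm_cons_eraseIdx i.2 e).trans ((List.erase_getElem i.2).symm.cons e)

theorem coe_restrict (ds : List ℕ) (I : Finset (Fin ds.length)) :
    (restrict ds I : Multiset ℕ) = I.val.map ds.get := by
  have I_val : I.val = (List.finRange ds.length).filter (· ∈ I) := by
    rw [← Multiset.filter_coe]
    exact congrArg Finset.val (Finset.filter_univ_mem I).symm
  rw [I_val, Multiset.map_coe, restrict]

theorem sum_antidiagonal_map_val {ι α M : Type*} [DecidableEq ι] [AddCommMonoid M] (s : Finset ι)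
    (f : ι → α) (g : Multiset α → Multiset α → M) :
    ((s.val.map f).antidiagonal.map fun p => g p.1 p.2).sum =
      ∑ t ∈ s.powerset, g (t.val.map f) ((s \ t).val.map f) := by
  induction s using Finset.induction_on generalizing g with
  | empty => simp
  | insert i s hi ih =>
    rw [Finset.insert_val_of_notMem hi, Multiset.map_cons, Multiset.antidiagonal_cons,
      Multiset.map_add, Multiset.sum_add, Multiset.map_map, Multiset.map_map,
      Finset.sum_powerset_insert hi]
    refine congrArg₂ _ ((ih fun U V => g U (f i ::ₘ V)).trans ?_)
      ((ih fun U V => g (f i ::ₘ U) V).trans ?_) <;>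
      refine Finset.sum_congr rfl fun t ht => ?_ <;>
      have hit : i ∉ t := fun h => hi (Finset.mem_powerset.mp ht h)
    · rw [Finset.insert_sdiff_of_notMem s hit, Finset.insert_val_of_notMem (by simp [hi]),
        Multiset.map_cons]
    · rw [Finset.insert_sdiff_insert, Finset.sdiff_insert_of_notMem hi,
        Finset.insert_val_of_notMem hit, Multiset.map_cons]

theorem sum_restrict (ds : List ℕ) (f : Multiset ℕ → Multiset ℕ → ℚ) :
    ∑ I : Finset (Fin ds.length), f (restrict ds I) (restrict ds Iᶜ) =
      ((ds : Multiset ℕ).antidiagonal.map fun p => f p.1 p.2).sum := by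
  have ds_eq : (ds : Multiset ℕ) = (Finset.univ : Finset (Fin ds.length)).val.map ds.get := by
    rw [← coe_restrict]
    simp [restrict]
  rw [ds_eq, sum_antidiagonal_map_val, Finset.powerset_univ]
  simp only [coe_restrict, Finset.compl_eq_univ_sdiff]

theorem B_cons (d : ℕ) (ds : List ℕ) :
    B (d :: ds) = ∑ i : Fin ds.length, (2 * (ds.get i : ℚ) + 1) * B (ds.set i (ds.get i + d)) +
      1 / 2 * ∑ a : Fin d, (B ((a : ℕ) :: (d - 1 - a) :: ds) + ∑ I : Finset (Fin ds.length),
        B ((a : ℕ) :: restrict ds I) * B ((d - 1 - a) :: restrict ds Iᶜ)) +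
      if d = 0 ∧ ds = [] then 1 / 8 else 0 := by
  by_cases h : d = 0 ∧ ds = []
  · obtain ⟨rfl, rfl⟩ := h
    rw [B.eq_2]
    simp
  · rw [if_neg h, add_zero, B]
    exact fun hd hds => h ⟨hd, hds⟩

theorem B_eq_connected {ds : List ℕ} (h : ds ≠ []) : B ds = connected ds := by
  induction hX : X ds using Nat.strong_induction_on generalizing ds with
  | _ N ih =>
    subst hX
    obtain ⟨d, ds, rfl⟩ := List.exists_cons_of_ne_nil h
    have ih_cons (e : ℕ) (es : List ℕ) (hlt : X (e :: es) < X (d :: ds)) :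
        B (e :: es) = connected (e ::ₘ es) := ih _ hlt (List.cons_ne_nil _ _) rfl
    have shift_terms : ∑ i : Fin ds.length,
        (2 * (ds.get i : ℚ) + 1) * B (ds.set i (ds.get i + d)) =
        ((ds : Multiset ℕ).map fun k : ℕ =>
          (2 * k + 1 : ℚ) * connected ((k + d) ::ₘ (ds : Multiset ℕ).erase k)).sum := by
      rw [Multiset.map_coe, Multiset.sum_coe, ← Fin.sum_univ_fun_getElem]
      refine Finset.sum_congr rfl fun i _ => ?_
      rw [ih _ (by rw [X_set, X_cons]; omega) (by simp [List.ne_nil_of_length_pos i.pos]) rfl,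
        coe_set]
      rfl
    have product_terms (a : Fin d) : ∑ I : Finset (Fin ds.length),
        B ((a : ℕ) :: restrict ds I) * B ((d - 1 - a) :: restrict ds Iᶜ) =
        ((ds : Multiset ℕ).antidiagonal.map fun q =>
          connected ((a : ℕ) ::ₘ q.1) * connected ((d - 1 - a) ::ₘ q.2)).sum := by
      rw [← sum_restrict ds fun U V => connected ((a : ℕ) ::ₘ U) * connected ((d - 1 - a) ::ₘ V)]
      refine Finset.sum_congr rfl fun I _ => ?_
      have := X_restrict_le ds I
      have := X_restrict_le ds Iᶜ
      rw [ih_cons _ _ (by simp only [X_cons]; omega), ih_cons _ _ (by simp only [X_cons]; omega)]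
    rw [B_cons, ← Multiset.cons_coe, connected_cons, shift_terms]
    simp only [Multiset.coe_eq_zero]
    rw [sum_cuts_eq_sum_range d fun i j => connected (i ::ₘ j ::ₘ ds) +
      ((ds : Multiset ℕ).antidiagonal.map fun q =>
        connected (i ::ₘ q.1) * connected (j ::ₘ q.2)).sum, Finset.sum_range]
    congr 3
    refine Finset.sum_congr rfl fun a _ => ?_
    rw [product_terms, ih_cons _ _ (by simp only [X_cons]; omega)]
    rfl

end Symmetry

theorem half_mem_ZHalf : (1 / 2 : ℚ) ∈ ZHalf := Algebra.subset_adjoin rfl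

theorem connected_mem_ZHalf (S : Multiset ℕ) : connected S ∈ ZHalf := by
  induction hN : weight S using Nat.strong_induction_on generalizing S with
  | _ N ih =>
    subst hN
    rcases Multiset.empty_or_exists_mem S with rfl | ⟨d, hd⟩
    · exact connected_zero ▸ zero_mem _
    obtain ⟨S, rfl⟩ := Multiset.exists_cons_of_mem hd
    rw [connected_cons]
    refine add_mem (add_mem (multiset_sum_mem _ ?_) (mul_mem half_mem_ZHalf (sum_mem fun p hp =>
      add_mem (ih _ ?_ _ rfl) (multiset_sum_mem _ ?_)))) ?_
    · simp only [Multiset.mem_map]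
      rintro _ ⟨k, hk, rfl⟩
      obtain ⟨T, rfl⟩ := Multiset.exists_cons_of_mem hk
      rw [Multiset.erase_cons_head]
      exact mul_mem (by exact_mod_cast natCast_mem ZHalf (2 * k + 1))
        (ih _ (by simp only [weight_cons]; omega) _ rfl)
    · have := mem_cuts.mp hp
      simp only [weight_cons]
      omega
    · simp only [Multiset.mem_map, Multiset.mem_antidiagonal]
      rintro _ ⟨q, rfl, rfl⟩
      have := mem_cuts.mp hp
      exact mul_mem (ih _ (by simp only [weight_cons, weight_add]; omega) _ rfl)
        (ih _ (by simp only [weight_cons, weight_add]; omega) _ rfl)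
    · split_ifs
      · exact (by norm_num : (1 / 2 : ℚ) ^ 3 = 1 / 8) ▸ pow_mem half_mem_ZHalf 3
      · exact zero_mem _

section OnePoint

/-- The function `(2d+1)!!³ / 4^(d+1)`, extended to all integers by its functional equation
`growth_add_one`. -/
def growth : ℤ → ℚ
  | Int.ofNat n => ((2 * n + 1)‼ : ℚ) ^ 3 / 4 ^ (n + 1)
  | Int.negSucc k => ∏ i ∈ Finset.range k, 4 / (-(2 * (i : ℚ) + 1)) ^ 3

theorem growth_natCast (n : ℕ) : growth n = ((2 * n + 1)‼ : ℚ) ^ 3 / 4 ^ (n + 1) := rfl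

theorem growth_neg_one : growth (-1) = 1 := rfl

theorem growth_add_one (d : ℤ) : growth (d + 1) = growth d * ((2 * d + 3) ^ 3 / 4) := by
  rcases d with n | _ | k
  · rw [Int.ofNat_eq_natCast, ← Nat.cast_succ, growth_natCast, growth_natCast, Nat.succ_eq_add_one,
      show 2 * (n + 1) + 1 = 2 * n + 1 + 2 by ring, Nat.doubleFactorial_add_two]
    push_cast
    field_simp
    ring
  · change ((1)‼ : ℚ) ^ 3 / 4 ^ 1 = 1 * ((2 * ((-1 : ℤ) : ℚ) + 3) ^ 3 / 4)
    norm_num [Nat.doubleFactorial]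
  · have odd : (2 * k + 1 : ℚ) ≠ 0 := by positivity
    change growth (Int.negSucc k) = _
    simp only [growth, Finset.prod_range_succ, Int.cast_negSucc]
    push_cast
    rw [show 2 * -((k : ℚ) + 1 + 1) + 3 = -(2 * k + 1) by ring, mul_assoc,
      div_mul_div_cancel₀ (pow_ne_zero _ (neg_ne_zero.mpr odd)), div_self four_ne_zero, mul_one]

theorem growth_ne_zero (d : ℤ) : growth d ≠ 0 := by
  rcases d with n | k
  · exact div_ne_zero (pow_ne_zero _ (Nat.cast_ne_zero.mpr (Nat.doubleFactorial_pos _).ne'))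
      (by positivity)
  · exact Finset.prod_ne_zero_iff.mpr fun i _ =>
      div_ne_zero four_ne_zero (pow_ne_zero _ (neg_ne_zero.mpr (by positivity)))

/-- The function `1 / (2^d d!)`, extended by zero to the negative integers. -/
def recip : ℤ → ℚ
  | Int.ofNat n => 1 / (2 ^ n * n !)
  | Int.negSucc _ => 0

theorem recip_natCast (n : ℕ) : recip n = 1 / (2 ^ n * n !) := rfl

theorem recip_zero : recip 0 = 1 := by
  norm_num [show recip 0 = 1 / (2 ^ 0 * 0 !) from rfl]

theorem recip_eq (d : ℤ) : recip d = (2 * d + 2) * recip (d + 1) := by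
  rcases d with n | _ | k
  · rw [Int.ofNat_eq_natCast, ← Nat.cast_succ, recip_natCast, recip_natCast, Nat.succ_eq_add_one,
      Nat.factorial_succ]
    have := Nat.factorial_ne_zero n
    push_cast
    field_simp
    ring
  · simp [recip]
  · change (0 : ℚ) = _ * 0
    rw [mul_zero]

theorem one_point (n : ℕ) : (2 * n + 1) * connected {n} = growth n * recip (n + 1) := by
  induction n with
  | zero =>
    rw [connected_singleton_zero, growth_natCast, ← Nat.cast_succ, recip_natCast]
    norm_num [Nat.doubleFactorial]
  | succ n ih =>
    have succ := connected_singleton_succ n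
    have growth_succ := growth_add_one n
    have recip_succ := recip_eq (n + 1)
    push_cast at growth_succ recip_succ ⊢
    rw [recip_succ] at ih
    rw [growth_succ]
    have : (n + 2 : ℚ) ≠ 0 := by positivity
    refine mul_left_cancel₀ this ?_
    linear_combination (2 * n + 3) / 8 * succ + (2 * n + 3) ^ 3 / 8 * ih

end OnePoint

section ExtendedEntry

theorem shift_one (l : ℕ) : shift l 1 = 0 := by
  refine expCoeff.injective (funext fun S => ?_)
  simp [expCoeff_shift, expCoeff_one]

theorem der_one (m : ℕ) : der m 1 = 0 := MvPowerSeries.pderiv_one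

theorem der_X (m k : ℕ) : der m (MvPowerSeries.X k) = if m = k then 1 else 0 := by
  refine (MvPowerSeries.pderiv_X m k).trans ?_
  rw [Pi.single_apply]
  exact ite_congr (propext eq_comm) (fun _ => rfl) fun _ => rfl

theorem shift_X (l k : ℕ) : shift l (MvPowerSeries.X k) =
    if l ≤ k then (2 * (k - l : ℕ) + 1 : ℚ) • MvPowerSeries.X (k - l) else 0 := by
  refine MvPowerSeries.pderiv.ext (fun m => ?_) ?_
  · change der m _ = der m _
    have key := congrArg (fun A : Module.End ℚ Series => A (MvPowerSeries.X k)) (der_mul_shift m l)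
    simp only [Module.End.mul_apply, LinearMap.add_apply, LinearMap.smul_apply, der_X,
      apply_ite (shift l), shift_one, map_zero, ite_self, zero_add] at key
    rw [key, apply_ite (der m), map_smul, der_X, map_zero]
    rcases le_or_gt l k with h | h
    · obtain ⟨j, rfl⟩ := Nat.exists_eq_add_of_le' h
      by_cases hm : m = j <;> simp [hm]
    · rw [if_neg (by omega), if_neg (by omega), smul_zero]
  · rw [constantCoeff_shift]
    split_ifs <;> simp

/-- The first derivative `∂_d F` of the free energy `F`, extended to negative `d` by the unstable
terms: `∂_{-1-k} F = (2k+1) t_k - δ_{k,0}`. -/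
noncomputable def extendedDer : ℤ → Series
  | Int.ofNat n => der n freeEnergy
  | Int.negSucc k => (2 * k + 1 : ℚ) • MvPowerSeries.X k - if k = 0 then 1 else 0

theorem extendedDer_natCast (n : ℕ) : extendedDer n = der n freeEnergy := rfl

theorem extendedDer_negSucc (k : ℕ) : extendedDer (Int.negSucc k) =
    (2 * k + 1 : ℚ) • MvPowerSeries.X k - if k = 0 then 1 else 0 := rfl

theorem der_extendedDer_natCast (l n : ℕ) : der l (extendedDer n) =
    shift l (extendedDer n) + (2 * n + 1 : ℚ) • extendedDer (n + l) +
      ∑ p ∈ cuts l, ((1 / 2 : ℚ) • der p.1 (der p.2 (extendedDer n)) +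
        der p.1 freeEnergy * der p.2 (extendedDer n)) := by
  have swap (m : ℕ) (f : Series) : der n (der m f) = der m (der n f) := pderiv_comm n m f
  have leibniz (f g : Series) : der n (f * g) = f * der n g + g * der n f :=
    (MvPowerSeries.pderiv ℚ n).leibniz f g
  have der_shift : der n (shift l freeEnergy) =
      shift l (der n freeEnergy) + (2 * n + 1 : ℚ) • der (n + l) freeEnergy :=
    congrArg (fun A : Module.End ℚ Series => A freeEnergy) (der_mul_shift n l)
  have symm := sum_cuts_swap l fun i j => der i freeEnergy * der j (der n freeEnergy)
  rw [← Nat.cast_add, extendedDer_natCast, extendedDer_natCast, ← swap, der_freeEnergy l]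
  simp only [map_add, map_smul, map_sum, der_one, smul_zero, add_zero, swap, leibniz, der_shift,
    Finset.sum_add_distrib, symm, ← Finset.smul_sum]
  module

theorem der_extendedDer_negSucc (l k : ℕ) : der l (extendedDer (Int.negSucc k)) =
    (if l = k then 2 * k + 1 else 0 : ℚ) • 1 := by
  rw [extendedDer_negSucc, map_sub, map_smul, der_X, apply_ite (der l), der_one, map_zero, ite_self,
    sub_zero, smul_ite, smul_zero, ite_smul, zero_smul]

theorem sum_cuts_mul_der_extendedDer_negSucc (l k : ℕ) :
    ∑ p ∈ cuts l, der p.1 freeEnergy * der p.2 (extendedDer (Int.negSucc k)) =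
      if k < l then (2 * k + 1 : ℚ) • der (l - 1 - k) freeEnergy else 0 := by
  simp only [der_extendedDer_negSucc]
  split_ifs with h
  · rw [Finset.sum_eq_single_of_mem (l - 1 - k, k) (mem_cuts.mpr (by dsimp only; omega))]
    · simp
    · intro p hp hne
      have := mem_cuts.mp hp
      rw [if_neg fun hk => hne (Prod.ext (by dsimp only; omega) hk), zero_smul, mul_zero]
  · refine Finset.sum_eq_zero fun p hp => ?_
    have := mem_cuts.mp hp
    rw [if_neg (by omega), zero_smul, mul_zero]

theorem der_extendedDer (l : ℕ) (d : ℤ) : der l (extendedDer d) =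
    shift l (extendedDer d) + (2 * d + 1 : ℚ) • extendedDer (d + l) +
      ∑ p ∈ cuts l, ((1 / 2 : ℚ) • der p.1 (der p.2 (extendedDer d)) +
        der p.1 freeEnergy * der p.2 (extendedDer d)) := by
  rcases d with n | k
  · exact_mod_cast der_extendedDer_natCast l n
  have second (i j : ℕ) : der i (der j (extendedDer (Int.negSucc k))) = 0 := by
    rw [der_extendedDer_negSucc, map_smul, der_one, smul_zero]
  simp only [second, smul_zero, zero_add]
  rw [sum_cuts_mul_der_extendedDer_negSucc, der_extendedDer_negSucc, extendedDer_negSucc, map_sub,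
    map_smul, shift_X, apply_ite (shift l), shift_one, map_zero, ite_self, sub_zero,
    Int.cast_negSucc]
  rcases lt_or_ge k l with h | h
  · rw [show Int.negSucc k + l = (l - 1 - k : ℕ) by omega, extendedDer_natCast,
      if_neg (show ¬l = k by omega), if_neg (show ¬l ≤ k by omega), if_pos h]
    push_cast
    module
  · obtain ⟨j, rfl⟩ := Nat.exists_eq_add_of_le' h
    rw [show Int.negSucc (j + l) + l = Int.negSucc j by omega, extendedDer_negSucc, if_pos h,
      if_neg (show ¬j + l < l by omega), Nat.add_sub_cancel]
    rcases eq_or_ne j 0 with rfl | hj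
    · rw [if_pos (by omega), if_pos rfl]
      push_cast
      module
    · rw [if_neg (by omega), if_neg hj]
      push_cast
      module

/-- The number `connected (d ::ₘ S)`, extended to negative `d`. -/
noncomputable def extended (d : ℤ) (S : Multiset ℕ) : ℚ := expCoeff (extendedDer d) S

theorem extended_natCast (n : ℕ) (S : Multiset ℕ) : extended n S = connected (n ::ₘ S) :=
  expCoeff_der n freeEnergy S

theorem extended_negSucc_zero (k : ℕ) : extended (Int.negSucc k) 0 = if k = 0 then -1 else 0 := by
  rw [extended, expCoeff_zero, extendedDer_negSucc]
  split_ifs <;> simp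

theorem extended_negSucc_cons (k m : ℕ) (S : Multiset ℕ) :
    extended (Int.negSucc k) (m ::ₘ S) = if m = k ∧ S = 0 then (2 * k + 1 : ℚ) else 0 := by
  rw [extended, ← expCoeff_der, der_extendedDer_negSucc, map_smul, Pi.smul_apply, expCoeff_one,
    smul_eq_mul, ite_zero_mul_ite_zero, mul_one]

theorem extended_zero (d : ℤ) : (2 * d + 1) * extended d 0 = growth d * recip (d + 1) := by
  rcases d with n | _ | k
  · exact_mod_cast (congrArg _ (extended_natCast n 0)).trans (one_point n)
  · rw [extended_negSucc_zero, show Int.negSucc 0 = -1 from rfl, growth_neg_one, neg_add_cancel,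
      recip_zero]
    norm_num
  · rw [extended_negSucc_zero, if_neg k.succ_ne_zero, mul_zero]
    exact (mul_zero _).symm

theorem extended_cons (d : ℤ) (l : ℕ) (S : Multiset ℕ) :
    extended d (l ::ₘ S) =
      (S.map fun k : ℕ => (2 * k + 1 : ℚ) * extended d ((k + l) ::ₘ S.erase k)).sum +
      (2 * d + 1) * extended (d + l) S +
      ∑ p ∈ cuts l, (1 / 2 * extended d (p.1 ::ₘ p.2 ::ₘ S) +
        (S.antidiagonal.map fun q => connected (p.1 ::ₘ q.1) * extended d (p.2 ::ₘ q.2)).sum) := by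
  have key := congrArg (fun f => expCoeff f S) (der_extendedDer l d)
  simp only [map_add, map_smul, map_sum, Pi.add_apply, Pi.smul_apply, Finset.sum_apply,
    smul_eq_mul, expCoeff_der, expCoeff_shift, expCoeff_mul, Multiset.cons_swap] at key
  exact key

end ExtendedEntry

section LeadingCoefficients

open Polynomial

variable {R : Type*} [CommRing R] {p q : R[X]} {m n : ℕ} {a b : R}

/-- The polynomial `q` has degree at most `n`, and its coefficient in degree `n` is `a`, possibly
zero. -/
def HasTopCoeff (q : R[X]) (n : ℕ) (a : R) : Prop := q.natDegree ≤ n ∧ q.coeff n = a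

theorem hasTopCoeff_C (a : R) : HasTopCoeff (Polynomial.C a) 0 a := ⟨by simp, by simp⟩

theorem hasTopCoeff_X_add_C (a : R) : HasTopCoeff (Polynomial.X + Polynomial.C a) 1 1 :=
  ⟨by compute_degree, by simp⟩

theorem HasTopCoeff.add (hp : HasTopCoeff p n a) (hq : HasTopCoeff q n b) :
    HasTopCoeff (p + q) n (a + b) :=
  ⟨natDegree_add_le_of_degree_le hp.1 hq.1, by rw [coeff_add, hp.2, hq.2]⟩

theorem HasTopCoeff.mul (hp : HasTopCoeff p m a) (hq : HasTopCoeff q n b) :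
    HasTopCoeff (p * q) (m + n) (a * b) :=
  ⟨natDegree_mul_le_of_le hp.1 hq.1,
    by rw [coeff_mul_add_eq_of_natDegree_le hp.1 hq.1, hp.2, hq.2]⟩

theorem HasTopCoeff.mul_X_add_C (hq : HasTopCoeff q n a) (b : R) :
    HasTopCoeff (q * (Polynomial.X + Polynomial.C b)) (n + 1) a := by
  simpa only [mul_one] using hq.mul (hasTopCoeff_X_add_C b)

theorem HasTopCoeff.of_lt (hq : HasTopCoeff q m a) (h : m < n) : HasTopCoeff q n 0 :=
  ⟨hq.1.trans h.le, coeff_eq_zero_of_natDegree_lt (hq.1.trans_lt h)⟩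

theorem HasTopCoeff.taylor (hq : HasTopCoeff q n a) (b : R) : HasTopCoeff (taylor b q) n a := by
  refine ⟨natDegree_taylor q b ▸ hq.1, ?_⟩
  rcases hq.1.lt_or_eq with h | h
  · rw [← hq.2, coeff_eq_zero_of_natDegree_lt h,
      coeff_eq_zero_of_natDegree_lt (by rwa [natDegree_taylor])]
  · rw [← h, coeff_taylor_natDegree, ← hq.2, ← h, leadingCoeff]

theorem HasTopCoeff.exists_eq_mul_X_add_C (hq : HasTopCoeff q (n + 1) a)
    (root : q.eval (-b) = 0) :
    ∃ r, HasTopCoeff r n a ∧ q = r * (Polynomial.X + Polynomial.C b) := by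
  obtain ⟨r, hr⟩ := dvd_iff_isRoot.mpr (show q.IsRoot (-b) from root)
  rw [C_neg, sub_neg_eq_add, mul_comm] at hr
  have degree : r.natDegree ≤ n := by
    nontriviality R
    rcases eq_or_ne r 0 with rfl | hr0
    · simp
    · have := hr ▸ hq.1
      rw [mul_comm, (monic_X_add_C b).natDegree_mul' hr0, natDegree_X_add_C] at this
      omega
  refine ⟨r, ⟨degree, ?_⟩, hr⟩
  rw [← hq.2, hr]
  exact ((HasTopCoeff.mul_X_add_C ⟨degree, rfl⟩ b).2).symm

theorem aeval_taylor {A : Type*} [CommRing A] [Algebra R A] (b : R) (q : R[X]) (x : A) :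
    aeval x (taylor b q) = aeval (x + algebraMap R A b) q := by
  simp [taylor_apply, aeval_comp]

end LeadingCoefficients

section GrowthClass

open Polynomial

/-- The element `1/2` of `ℤ[1/2]`. -/
def half : ZHalf := ⟨1 / 2, half_mem_ZHalf⟩

theorem algebraMap_half_sq : algebraMap ZHalf ℚ (half ^ 2) = 1 / 4 := by
  rw [map_pow, show algebraMap ZHalf ℚ half = 1 / 2 from rfl]
  norm_num

/-- The function `f` of the integer `d` is `growth d * recip (d + K)`, i.e. up to powers of `2`
`(2d+1)!!³ / (d+K)!`, times a polynomial in `2d` over `ℤ[1/2]` of degree at most `w - 2 + K` in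
which `c` is the coefficient of that degree. The number `K` is not pinned down: raising it
by one multiplies the polynomial by a monic linear factor. -/
def HasGrowth (w : ℕ) (c : ZHalf) (f : ℤ → ℚ) : Prop :=
  ∃ (K N : ℕ) (q : ZHalf[X]), N + 2 = w + K ∧ HasTopCoeff q N c ∧
    ∀ d : ℤ, f d = growth d * aeval (2 * d : ℚ) q * recip (d + K)

namespace HasGrowth

variable {w w' : ℕ} {c c' : ZHalf} {f f' : ℤ → ℚ}

theorem congr (h : HasGrowth w c f) (hw : w = w') (hc : c = c') (hf : ∀ d, f d = f' d) :
    HasGrowth w' c' f' := by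
  rwa [← hw, ← hc, ← funext hf]

theorem exists_forall_ge (h : HasGrowth w c f) : ∃ K₀, ∀ K ≥ K₀, ∃ (N : ℕ) (q : ZHalf[X]),
    N + 2 = w + K ∧ HasTopCoeff q N c ∧
      ∀ d : ℤ, f d = growth d * aeval (2 * d : ℚ) q * recip (d + K) := by
  obtain ⟨K₀, N, q, hN, hq, hf⟩ := h
  refine ⟨K₀, fun K hK => ?_⟩
  induction K, hK using Nat.le_induction with
  | base => exact ⟨N, q, hN, hq, hf⟩
  | succ K _ ih =>
    obtain ⟨N, q, hN, hq, hf⟩ := ih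
    refine ⟨N + 1, _, by omega, hq.mul_X_add_C ((2 * K + 2 : ℕ) : ZHalf), fun d => ?_⟩
    rw [hf, recip_eq]
    simp only [map_mul, map_add, aeval_X, map_natCast]
    push_cast
    rw [add_assoc d]
    ring

theorem add (h : HasGrowth w c f) (h' : HasGrowth w c' f') :
    HasGrowth w (c + c') (fun d => f d + f' d) := by
  obtain ⟨K₁, h₁⟩ := h.exists_forall_ge
  obtain ⟨K₂, h₂⟩ := h'.exists_forall_ge
  obtain ⟨N, q, hN, hq, hf⟩ := h₁ (max K₁ K₂) (le_max_left _ _)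
  obtain ⟨N', q', hN', hq', hf'⟩ := h₂ (max K₁ K₂) (le_max_right _ _)
  obtain rfl : N = N' := by omega
  refine ⟨_, N, q + q', hN, hq.add hq', fun d => ?_⟩
  simp only [hf, hf', map_add]
  ring

theorem const_mul (h : HasGrowth w c f) (a : ZHalf) :
    HasGrowth w (a * c) (fun d => a * f d) := by
  obtain ⟨K, N, q, hN, hq, hf⟩ := h
  refine ⟨K, N, Polynomial.C a * q, hN, zero_add N ▸ (hasTopCoeff_C a).mul hq, fun d => ?_⟩
  simp only [hf, map_mul, aeval_C, show algebraMap ZHalf ℚ a = a from rfl]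
  ring

theorem of_lt (h : HasGrowth w c f) (hw : w < w') : HasGrowth w' 0 f := by
  obtain ⟨K, N, q, hN, hq, hf⟩ := h
  exact ⟨K, N + (w' - w), q, by omega, hq.of_lt (by omega), hf⟩

theorem zero (w : ℕ) : HasGrowth w 0 (fun _ => 0) :=
  ⟨2, w, 0, rfl, by simp [HasTopCoeff], by simp⟩

theorem multiset_sum {ι : Type*} (s : Multiset ι) {F : ι → ℤ → ℚ}
    (h : ∀ i ∈ s, HasGrowth w 0 (F i)) : HasGrowth w 0 (fun d => (s.map fun i => F i d).sum) := by
  induction s using Multiset.induction with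
  | empty => simpa using zero w
  | cons i s ih =>
    have := (h i (Multiset.mem_cons_self _ _)).add
      (ih fun j hj => h j (Multiset.mem_cons_of_mem hj))
    simpa using this

theorem linear_mul (h : HasGrowth w c f) (b : ℕ) :
    HasGrowth (w + 1) c (fun d => (2 * d + b) * f d) := by
  obtain ⟨K, N, q, hN, hq, hf⟩ := h
  refine ⟨K, N + 1, _, by omega, hq.mul_X_add_C (b : ZHalf), fun d => ?_⟩
  simp only [hf, map_mul, map_add, aeval_X, map_natCast]
  ring

theorem comp_add_one (h : HasGrowth w c f) :
    HasGrowth (w + 2) (c * half ^ 2) (fun d => f (d + 1)) := by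
  obtain ⟨K, N, q, hN, hq, hf⟩ := h
  have top := ((((hq.taylor 2).mul_X_add_C 3).mul_X_add_C 3).mul_X_add_C 3).mul
    (hasTopCoeff_C (half ^ 2))
  refine ⟨K + 1, N + 3, _, by omega, top, fun d => ?_⟩
  simp only [hf, growth_add_one, map_mul, map_add, aeval_X, aeval_C, aeval_taylor,
    algebraMap_half_sq, map_ofNat]
  push_cast
  rw [add_right_comm d, add_assoc d, mul_add, mul_one]
  ring

theorem comp_add (h : HasGrowth w c f) (l : ℕ) :
    HasGrowth (w + 2 * l) (c * half ^ (2 * l)) (fun d => f (d + l)) := by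
  induction l with
  | zero => simpa using h
  | succ l ih =>
    refine ih.comp_add_one.congr (by ring) (by ring) fun d => ?_
    rw [Nat.cast_succ, ← add_assoc, add_right_comm]

-- A zero of `f` at `d = -K`, where `recip (d + K) = 1`, is a zero of the polynomial factor at
-- `2d = -2K`, and dividing it out lowers `K` by one.
theorem exists_polynomial (h : HasGrowth w c f) (hw : 2 ≤ w)
    (vanish : ∀ k : ℕ, f (Int.negSucc k) = 0) :
    ∃ q : ZHalf[X], HasTopCoeff q (w - 2) c ∧
      ∀ d : ℤ, f d = growth d * aeval (2 * d : ℚ) q * recip d := by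
  obtain ⟨K, N, q, hN, hq, hf⟩ := h
  induction K generalizing N q with
  | zero =>
    obtain rfl : N = w - 2 := by omega
    exact ⟨q, hq, by simpa using hf⟩
  | succ K ih =>
    obtain ⟨N, rfl⟩ : ∃ M, N = M + 1 := ⟨N - 1, by omega⟩
    have aeval_zero : aeval (2 * (Int.negSucc K : ℤ) : ℚ) q = 0 := by
      have zero := hf (Int.negSucc K)
      rw [vanish, show Int.negSucc K + ((K + 1 : ℕ) : ℤ) = 0 by omega, recip_zero, mul_one] at zero
      exact (mul_eq_zero.mp zero.symm).resolve_left (growth_ne_zero _)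
    have root : q.eval (-((2 * K + 2 : ℕ) : ZHalf)) = 0 := by
      have point : (2 * (Int.negSucc K : ℤ) : ℚ) =
          algebraMap ZHalf ℚ (-((2 * K + 2 : ℕ) : ZHalf)) := by
        rw [map_neg, map_natCast, Int.cast_negSucc]
        push_cast
        ring
      rw [point, aeval_algebraMap_apply] at aeval_zero
      exact Subtype.ext aeval_zero
    obtain ⟨r, hr, rfl⟩ := hq.exists_eq_mul_X_add_C root
    refine ih N r (by omega) hr fun d => ?_
    rw [hf, recip_eq (d + K)]
    simp only [map_mul, map_add, aeval_X, map_natCast]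
    push_cast
    rw [add_assoc d]
    ring

end HasGrowth

theorem hasGrowth_extended_add_one_zero :
    HasGrowth 2 (half ^ 2) (fun d => extended (d + 1) 0) := by
  have top := ((hasTopCoeff_X_add_C 3).mul_X_add_C 3).mul (hasTopCoeff_C (half ^ 2))
  refine ⟨2, 2, _, rfl, one_mul (half ^ 2) ▸ top, fun d => ?_⟩
  have value := extended_zero (d + 1)
  rw [growth_add_one, add_assoc d, one_add_one_eq_two] at value
  have odd : (2 * d + 3 : ℚ) ≠ 0 := by exact_mod_cast (by omega : 2 * d + 3 ≠ 0)
  refine mul_left_cancel₀ odd ?_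
  simp only [map_mul, map_add, aeval_X, aeval_C, algebraMap_half_sq, map_ofNat]
  push_cast at value ⊢
  linear_combination value

theorem hasGrowth_extended_add_zero (l : ℕ) :
    HasGrowth (2 * l + 1) (half ^ (2 * l)) (fun d => (2 * d + 1) * extended (d + l) 0) := by
  rcases l with _ | l
  · refine ⟨1, 0, 1, rfl, ⟨by simp, by simp⟩, fun d => ?_⟩
    simpa using extended_zero d
  · refine ((hasGrowth_extended_add_one_zero.comp_add l).linear_mul 1).congr (by ring) (by ring)
      fun d => ?_
    push_cast
    rw [add_assoc d]

theorem hasGrowth_extended_add {S : Multiset ℕ} (l : ℕ)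
    (h : S ≠ 0 → HasGrowth (weight S) (half ^ (2 * S.sum)) (fun d => extended d S)) :
    HasGrowth (weight (l ::ₘ S)) (half ^ (2 * (l ::ₘ S).sum))
      (fun d => (2 * d + 1) * extended (d + l) S) := by
  rcases eq_or_ne S 0 with rfl | hS
  · exact (hasGrowth_extended_add_zero l).congr (by simp [weight]) (by simp) fun _ => rfl
  · refine (((h hS).comp_add l).linear_mul 1).congr (by rw [weight_cons]; ring)
      (by rw [Multiset.sum_cons]; ring) fun d => ?_
    rw [Nat.cast_one]

theorem hasGrowth_extended_lower {l : ℕ} {S : Multiset ℕ}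
    (lower : ∀ m T, weight (m ::ₘ T) < weight (l ::ₘ S) → ∀ a : ZHalf,
      HasGrowth (weight (l ::ₘ S)) 0 (fun d => a * extended d (m ::ₘ T))) :
    HasGrowth (weight (l ::ₘ S)) 0 (fun d => extended d (l ::ₘ S) -
      (2 * d + 1) * extended (d + l) S) := by
  have merge_terms : HasGrowth (weight (l ::ₘ S)) 0 (fun d =>
      (S.map fun k : ℕ => (2 * k + 1 : ℚ) * extended d ((k + l) ::ₘ S.erase k)).sum) := by
    refine HasGrowth.multiset_sum S fun k hk => ?_
    obtain ⟨T, rfl⟩ := Multiset.exists_cons_of_mem hk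
    rw [Multiset.erase_cons_head]
    refine (lower (k + l) T (by simp only [weight_cons]; omega) (2 * k + 1 : ℕ)).congr rfl rfl
      fun d => ?_
    push_cast
    rfl
  have cut_terms : HasGrowth (weight (l ::ₘ S)) 0 (fun d =>
      ∑ p ∈ cuts l, (1 / 2 * extended d (p.1 ::ₘ p.2 ::ₘ S) + (S.antidiagonal.map fun q =>
        connected (p.1 ::ₘ q.1) * extended d (p.2 ::ₘ q.2)).sum)) := by
    refine HasGrowth.multiset_sum (cuts l).val fun p hp => ?_
    have cut := mem_cuts.mp hp
    have quadratic := HasGrowth.multiset_sum (w := weight (l ::ₘ S)) S.antidiagonal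
      (F := fun q d => connected (p.1 ::ₘ q.1) * extended d (p.2 ::ₘ q.2)) fun q hq => by
        rw [Multiset.mem_antidiagonal] at hq
        subst hq
        exact lower p.2 q.2 (by simp only [weight_cons, weight_add]; omega)
          ⟨_, connected_mem_ZHalf (p.1 ::ₘ q.1)⟩
    exact ((lower p.1 (p.2 ::ₘ S) (by simp only [weight_cons]; omega) half).add quadratic).congr
      rfl (add_zero 0) fun d => rfl
  refine (merge_terms.add cut_terms).congr rfl (add_zero 0) fun d => ?_
  rw [extended_cons]
  ring

theorem hasGrowth_extended {S : Multiset ℕ} (hS : S ≠ 0) :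
    HasGrowth (weight S) (half ^ (2 * S.sum)) (fun d => extended d S) := by
  induction hN : weight S using Nat.strong_induction_on generalizing S with
  | _ N ih =>
    subst hN
    obtain ⟨l, hl⟩ := Multiset.exists_mem_of_ne_zero hS
    obtain ⟨S, rfl⟩ := Multiset.exists_cons_of_mem hl
    have leading := hasGrowth_extended_add (S := S) l
      fun hS => ih _ (by rw [weight_cons]; omega) hS rfl
    have lower := hasGrowth_extended_lower (l := l) (S := S) fun m T h a =>
      ((ih _ h Multiset.cons_ne_zero rfl).const_mul a).of_lt h
    exact (leading.add lower).congr rfl (add_zero _) fun d => add_sub_cancel _ _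

end GrowthClass

section FixedTuple

open Polynomial

theorem card_le_weight (S : Multiset ℕ) : Multiset.card S ≤ weight S := by
  induction S using Multiset.induction with
  | empty => simp
  | cons d S ih =>
    rw [Multiset.card_cons, weight_cons]
    omega

-- The unstable value at `d = -m-1` does not vanish, but `2d + 2m + 2` does.
theorem exists_polynomial_connected_pair (m : ℕ) :
    ∃ q : ZHalf[X], HasTopCoeff q (2 * m) (half ^ (2 * m)) ∧ ∀ d : ℕ,
      (2 * d + 2 * m + 2) * connected {d, m} = growth d * aeval (2 * d : ℚ) q * recip d := by
  have stable : HasGrowth (2 * m + 2) (half ^ (2 * m))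
      (fun d => (2 * d + (2 * m + 2 : ℕ)) * extended d {m}) :=
    ((hasGrowth_extended (Multiset.singleton_ne_zero m)).linear_mul _).congr
      (by simp [weight]) (by simp) fun _ => rfl
  obtain ⟨q, top, value⟩ := stable.exists_polynomial (by omega) fun k => by
    rw [← Multiset.cons_zero, extended_negSucc_cons]
    split_ifs with h
    · rw [h.1, Int.cast_negSucc]
      push_cast
      ring
    · rw [mul_zero]
  refine ⟨q, top, fun d => ?_⟩
  have := value d
  rw [Int.cast_natCast, extended_natCast] at this
  rw [← this, Multiset.insert_eq_cons]
  push_cast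
  ring

theorem exists_polynomial_connected_of_two_le_card {S : Multiset ℕ} (hS : 2 ≤ Multiset.card S) :
    ∃ q : ZHalf[X], HasTopCoeff q (weight S - 2) (half ^ (2 * S.sum)) ∧ ∀ d : ℕ,
      connected (d ::ₘ S) = growth d * aeval (2 * d : ℚ) q * recip d := by
  have ne_zero : S ≠ 0 := Multiset.card_pos.mp (by omega)
  obtain ⟨q, top, value⟩ :=
    (hasGrowth_extended ne_zero).exists_polynomial (hS.trans (card_le_weight S)) fun k => by
      obtain ⟨m, hm⟩ := Multiset.exists_mem_of_ne_zero ne_zero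
      obtain ⟨T, rfl⟩ := Multiset.exists_cons_of_mem hm
      rw [extended_negSucc_cons, if_neg]
      rintro ⟨-, rfl⟩
      simp at hS
  exact ⟨q, top, fun d => by simpa [extended_natCast] using value d⟩

theorem HasTopCoeff.exists_monic {q : ZHalf[X]} {N s : ℕ} (hq : HasTopCoeff q N (half ^ s))
    (w : ℕ) : ∃ P : ZHalf[X], P.Monic ∧ P.natDegree = N ∧
      ∀ x : ℚ, aeval (x + w) P = 2 ^ s * aeval x q := by
  have two_mul_half : (2 : ZHalf) * half = 1 := Subtype.ext (mul_one_div_cancel two_ne_zero)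
  have top := (hasTopCoeff_C (2 ^ s : ZHalf)).mul (hq.taylor (-w))
  rw [zero_add, ← mul_pow, two_mul_half, one_pow] at top
  refine ⟨_, monic_of_natDegree_le_of_coeff_eq_one N top.1 top.2,
    natDegree_eq_of_le_of_coeff_ne_zero top.1 (top.2 ▸ one_ne_zero), fun x => ?_⟩
  rw [map_mul, aeval_C, aeval_taylor, map_neg, map_natCast, add_neg_cancel_right, map_pow,
    map_ofNat]

theorem exists_monic_connected {S : Multiset ℕ} (hS : S ≠ 0) :
    ∃ P : ZHalf[X], P.Monic ∧
      P.natDegree + 2 = weight S + (if Multiset.card S = 1 then 1 else 0) ∧ ∀ d : ℕ,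
        (weight (d ::ₘ S) : ℚ) ^ (if Multiset.card S = 1 then 1 else 0) *
            (2 ^ (2 * S.sum) * connected (d ::ₘ S)) =
          growth d * aeval (weight (d ::ₘ S) : ℚ) P * recip d := by
  have weight_eq (d : ℕ) : (weight (d ::ₘ S) : ℚ) = 2 * d + (weight S + 1 : ℕ) := by
    rw [weight_cons]
    push_cast
    ring
  by_cases card_eq : Multiset.card S = 1
  · obtain ⟨m, rfl⟩ := Multiset.card_eq_one.mp card_eq
    obtain ⟨q, top, value⟩ := exists_polynomial_connected_pair m
    obtain ⟨P, monic, degree, aeval_P⟩ := top.exists_monic (weight {m} + 1)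
    refine ⟨P, monic, by simp [degree, weight], fun d => ?_⟩
    rw [if_pos card_eq, weight_eq, aeval_P, Multiset.sum_singleton, mul_left_comm (growth d),
      mul_assoc (2 ^ (2 * m)), ← value, Multiset.insert_eq_cons]
    simp only [weight, Multiset.map_singleton, Multiset.sum_singleton]
    push_cast
    ring
  · have two_le : 2 ≤ Multiset.card S := by
      have := Multiset.card_pos.mpr hS
      omega
    obtain ⟨q, top, value⟩ := exists_polynomial_connected_of_two_le_card two_le
    obtain ⟨P, monic, degree, aeval_P⟩ := top.exists_monic (weight S + 1)
    have := card_le_weight S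
    refine ⟨P, monic, by rw [degree, if_neg card_eq]; omega, fun d => ?_⟩
    rw [if_neg card_eq, weight_eq, aeval_P, value]
    ring

end FixedTuple

section NormalizedNumbers

open Polynomial (aeval)
open scoped Polynomial

/-- The factor `(2d+1)!!³ / (2^(d+1) d!)` through which `C(λ, d)` depends on `d`, apart from the
dependence on `X(λ, d)`. -/
def factor (d : ℕ) : ℚ := ((2 * d + 1)‼ : ℚ) ^ 3 / (2 ^ (d + 1) * (d ! : ℚ))

theorem factor_pos (d : ℕ) : 0 < factor d := by
  have := Nat.doubleFactorial_pos (2 * d + 1)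
  unfold factor
  positivity

theorem factor_eq (d : ℕ) : factor d = 2 ^ (2 * d + 1) * (growth d * recip d) := by
  have := Nat.factorial_ne_zero d
  rw [growth_natCast, recip_natCast, factor, show (4 : ℚ) = 2 ^ 2 by norm_num, ← pow_mul]
  field_simp
  ring

theorem factor_succ (d : ℕ) : factor (d + 1) * (2 * d + 2) = factor d * (2 * d + 3) ^ 3 := by
  have growth_succ := growth_add_one d
  rw [factor_eq, factor_eq, recip_eq d]
  push_cast at growth_succ ⊢
  rw [growth_succ]
  ring

theorem factor_sub_div {e s : ℕ} (hs : s ≤ e) :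
    factor (e - s) / factor e = ∏ i ∈ Finset.Icc 1 s,
      (2 * (e + 1 : ℚ) - 2 * i) / (2 * (e + 1 : ℚ) - 2 * i + 1) ^ 3 := by
  induction s with
  | zero => simp [(factor_pos e).ne']
  | succ s ih =>
    obtain ⟨m, rfl⟩ : ∃ m, e = m + (s + 1) := ⟨e - (s + 1), by omega⟩
    rw [Finset.prod_Icc_succ_top (by omega), ← ih (by omega),
      show m + (s + 1) - s = m + 1 by omega, Nat.add_sub_cancel, div_mul_div_comm]
    push_cast
    rw [show 2 * ((m : ℚ) + (s + 1) + 1) - 2 * (s + 1) = 2 * m + 2 by ring,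
      show (2 * (m : ℚ) + 2 + 1) = 2 * m + 3 by ring, factor_succ, mul_comm (factor (m + (s + 1))),
      mul_comm (factor m)]
    exact (mul_div_mul_left _ _ (by positivity)).symm

theorem C_eq_connected {ds : List ℕ} (h : ds ≠ []) :
    C ds = 2 ^ (2 * ds.sum + 1) * connected ds / ((weight ds - 1)! : ℚ) := by
  have double_factorials : (ds.map fun d => ((2 * d + 1)‼ : ℚ)).prod ≠ 0 := by
    refine List.prod_ne_zero fun zero_mem => ?_
    obtain ⟨d, -, hd⟩ := List.mem_map.mp zero_mem
    exact (Nat.doubleFactorial_pos (2 * d + 1)).ne' (Nat.cast_eq_zero.mp hd)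
  rw [C, number, B_eq_connected h, weight_coe, genus,
    show 2 * (ds.sum + 1) - 1 = 2 * ds.sum + 1 by omega]
  field_simp

theorem C_singleton (e : ℕ) : C [e] = factor e / ((2 * e + 2)! : ℚ) := by
  have odd : (2 * e + 1 : ℚ) ≠ 0 := by positivity
  have factorial : ((2 * e)! : ℚ) ≠ 0 := Nat.cast_ne_zero.mpr (Nat.factorial_ne_zero _)
  have recip_succ := recip_eq e
  push_cast at recip_succ
  rw [C_eq_connected (List.cons_ne_nil e []), Multiset.coe_singleton, factor_eq, recip_succ,
    List.sum_singleton, mul_left_comm (growth e), ← one_point,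
    show weight {e} - 1 = 2 * e by simp [weight], Nat.factorial_succ, Nat.factorial_succ]
  push_cast
  field_simp
  ring

theorem C_singleton_ne_zero (e : ℕ) : C [e] ≠ 0 := by
  rw [C_singleton]
  exact div_ne_zero (factor_pos e).ne' (Nat.cast_ne_zero.mpr (Nat.factorial_ne_zero _))

theorem X_eq (ds : List ℕ) : X ds = 2 * ds.sum + ds.length := by
  induction ds with
  | nil => rfl
  | cons d ds ih =>
    rw [X_cons, ih, List.sum_cons, List.length_cons]
    ring

/-- The polynomial `P` expresses the normalized numbers `C(λ, d)` in terms of `X(λ, d)`. The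
number `n` of entries of `(λ, d)` is `lam.length + 1`, so that the exponent is `δ_{n,2}`. -/
def IsNumberPolynomial (lam : List ℕ) (P : ZHalf[X]) : Prop :=
  ∀ d : ℕ, C (lam ++ [d]) =
    1 / ((X (lam ++ [d]) : ℚ) ^ (if lam.length + 1 = 2 then 1 else 0)
        * ((X (lam ++ [d]) - 1)! : ℚ)) * factor d * aeval (X (lam ++ [d]) : ℚ) P

theorem exists_monic_polynomial {lam : List ℕ} (hlam : lam ≠ []) :
    ∃ P : ZHalf[X], P.Monic ∧
      P.natDegree + 2 = X lam + (if lam.length + 1 = 2 then 1 else 0) ∧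
      IsNumberPolynomial lam P := by
  have coe_append (d : ℕ) : (↑(lam ++ [d]) : Multiset ℕ) = d ::ₘ lam :=
    Multiset.coe_eq_coe.mpr (List.perm_append_singleton d lam)
  obtain ⟨P, monic, degree, value⟩ := exists_monic_connected (S := lam) (by simpa using hlam)
  rw [weight_coe, Multiset.coe_card] at degree
  rw [Multiset.coe_card] at value
  simp only [← coe_append, weight_coe, Multiset.sum_coe] at value
  have delta : (if lam.length + 1 = 2 then 1 else 0) = if lam.length = 1 then 1 else 0 :=
    if_congr (by omega) rfl rfl
  refine ⟨P, monic, by rw [degree, delta], fun d => ?_⟩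
  have X_ne_zero : (X (lam ++ [d]) : ℚ) ≠ 0 := Nat.cast_ne_zero.mpr <| by
    rw [X_eq, List.length_append, List.length_singleton]
    omega
  have factorial : ((X (lam ++ [d]) - 1)! : ℚ) ≠ 0 := Nat.cast_ne_zero.mpr (Nat.factorial_ne_zero _)
  rw [delta, C_eq_connected (by simp), weight_coe, List.sum_append, List.sum_singleton, factor_eq]
  field_simp
  linear_combination 2 ^ (2 * d + 1) * value d

end NormalizedNumbers

section Ratios

open Polynomial (aeval)
open scoped Polynomial

theorem factorial_add (a m : ℕ) : (a + m)! = a ! * ∏ j ∈ Finset.Icc 1 m, (a + j) := by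
  induction m with
  | zero => simp
  | succ m ih =>
    rw [Finset.prod_Icc_succ_top (by omega), ← mul_assoc, ← ih, ← add_assoc, Nat.factorial_succ,
      mul_comm]

theorem pow_mul_factorial_eq (a : ℕ) {l : ℕ} (hl : l ≠ 0) :
    (a + l) ^ (if l + 1 = 2 then 1 else 0) * (a + l - 1)! =
      (a + 1)! * ∏ j ∈ Finset.Icc 1 (l + 1 - 3), (a + 1 + j) := by
  rcases l with _ | _ | m
  · contradiction
  · simp [Nat.factorial_succ]
  · rw [if_neg (by omega), pow_zero, one_mul, show m + 1 + 1 + 1 - 3 = m by omega,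
      ← factorial_add, show a + (m + 1 + 1) - 1 = a + 1 + m by omega]

theorem C_div_C_singleton {lam : List ℕ} {P : ZHalf[X]} (hlam : lam ≠ [])
    (hP : IsNumberPolynomial lam P) {g : ℕ} (hg : lam.sum + 1 ≤ g) :
    C (lam ++ [g - 1 - lam.sum]) / C [g - 1] =
      aeval (2 * (g : ℚ) - 2 + (lam.length + 1 : ℕ)) P
        / (∏ j ∈ Finset.Icc 1 (lam.length + 1 - 3), (2 * (g : ℚ) + j))
        * ∏ i ∈ Finset.Icc 1 lam.sum, (2 * (g : ℚ) - 2 * i) / (2 * (g : ℚ) - 2 * i + 1) ^ 3 := by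
  obtain ⟨e, rfl⟩ : ∃ e, g = e + 1 := ⟨g - 1, by omega⟩
  have X_append : X (lam ++ [e - lam.sum]) = 2 * e + 1 + lam.length := by
    rw [X_eq, List.sum_append, List.sum_singleton, List.length_append, List.length_singleton]
    omega
  have factorial : ((2 * e + 2)! : ℚ) ≠ 0 := Nat.cast_ne_zero.mpr (Nat.factorial_ne_zero _)
  have := (factor_pos e).ne'
  have point : (2 * e + 1 + lam.length : ℕ) = 2 * ((e + 1 : ℕ) : ℚ) - 2 + (lam.length + 1 : ℕ) := by
    push_cast
    ring
  rw [Nat.add_sub_cancel, hP (e - lam.sum), C_singleton, X_append, ← Nat.cast_pow, ← Nat.cast_mul,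
    pow_mul_factorial_eq _ (mt List.length_eq_zero_iff.mp hlam), point, Nat.cast_succ e,
    ← factor_sub_div (by omega)]
  push_cast
  rw [show 2 * (e : ℚ) + 1 + 1 = 2 * (e + 1) by ring]
  field_simp

theorem exists_monic_polynomial_ratio (lam : List ℕ) :
    ∃ P : ZHalf[X], P.Monic ∧
      (2 ≤ lam.length + 1 →
        P.natDegree + 2 = X lam + (if lam.length + 1 = 2 then 1 else 0) ∧
        IsNumberPolynomial lam P) ∧
      ∀ g : ℕ, lam.sum + 1 ≤ g →
        C (lam ++ [g - 1 - lam.sum]) / C [g - 1] =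
          aeval (2 * (g : ℚ) - 2 + (lam.length + 1 : ℕ)) P
            / (∏ j ∈ Finset.Icc 1 (lam.length + 1 - 3), (2 * (g : ℚ) + j))
            * ∏ i ∈ Finset.Icc 1 lam.sum,
                (2 * (g : ℚ) - 2 * i) / (2 * (g : ℚ) - 2 * i + 1) ^ 3 := by
  rcases eq_or_ne lam [] with rfl | hlam
  · exact ⟨1, Polynomial.monic_one, fun h => absurd h (by decide),
      fun g _ => by simp [C_singleton_ne_zero (g - 1)]⟩
  · obtain ⟨P, monic, degree, formula⟩ := exists_monic_polynomial hlam
    exact ⟨P, monic, fun _ => ⟨degree, formula⟩, fun _ => C_div_C_singleton hlam formula⟩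

end Ratios

section Pochhammer

open Polynomial

theorem ascPochhammer_eval_sub {R : Type*} [CommRing R] (s m : ℕ) (y : R) :
    (ascPochhammer R (2 * s + m)).eval (y - 2 * s) =
      (∏ i ∈ Finset.Icc 1 s, (y - 2 * i)) * (∏ i ∈ Finset.Icc 1 s, (y - 2 * i + 1))
        * (ascPochhammer R m).eval y := by
  induction s with
  | zero => simp
  | succ s ih =>
    rw [Finset.prod_Icc_succ_top (by omega), Finset.prod_Icc_succ_top (by omega),
      show 2 * (s + 1) + m = 2 * s + m + 1 + 1 by ring, ascPochhammer_succ_left,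
      ascPochhammer_succ_left]
    simp only [eval_mul, eval_X, eval_comp, eval_add, eval_one]
    rw [show y - 2 * ((s + 1 : ℕ) : R) + 1 + 1 = y - 2 * s by push_cast; ring, ih]
    ring

theorem ascPochhammer_eval_succ {R : Type*} [CommSemiring R] (m : ℕ) (y : R) :
    (ascPochhammer R (m + 1)).eval y = y * ∏ j ∈ Finset.Icc 1 m, (y + j) := by
  induction m with
  | zero => simp
  | succ m ih =>
    rw [ascPochhammer_succ_eval, ih, Finset.prod_Icc_succ_top (by omega), mul_assoc]

theorem exists_ascPochhammer_eval_two_mul (m : ℕ) :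
    ∃ T : ZHalf[X], ∀ x : ℚ, (ascPochhammer ℚ m).eval (2 * x) =
      aeval x T * ∏ j ∈ Finset.Icc 1 (m - 1), (2 * x + j) := by
  rcases m with _ | m
  · exact ⟨1, by simp⟩
  · exact ⟨2 * Polynomial.X, fun x => by simp [ascPochhammer_eval_succ, map_ofNat]⟩

-- The even factors of the two products on the left combine to a polynomial over `ℤ[1/2]`, the odd
-- ones cancel up to a linear factor.
theorem exists_pochhammer_factor (s m : ℕ) :
    ∃ T : ZHalf[X], ∀ x : ℚ,
      (ascPochhammer ℚ (2 * s + (m + 2))).eval (2 * x - 2 * s - 2)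
          * ∏ i ∈ Finset.Icc 1 s, (2 * x - 2 * i)
        = aeval x T * (∏ j ∈ Finset.Icc 1 (m - 1), (2 * x + j))
          * ∏ i ∈ Finset.Icc 1 s, (2 * x - 2 * i + 1) := by
  obtain ⟨T, hT⟩ := exists_ascPochhammer_eval_two_mul m
  let E (r : ℕ) : ZHalf[X] := ∏ i ∈ Finset.Icc 1 r, (2 * Polynomial.X - 2 * (i : ZHalf[X]))
  have aeval_E (r : ℕ) (x : ℚ) : aeval x (E r) = ∏ i ∈ Finset.Icc 1 r, (2 * x - 2 * i) := by
    simp [E, map_ofNat]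
  refine ⟨E s * E (s + 1) * (2 * Polynomial.X - ((2 * s + 1 : ℕ) : ZHalf[X])) * T, fun x => ?_⟩
  have split := ascPochhammer_eval_sub (s + 1) m (2 * x)
  rw [hT, ← aeval_E, Finset.prod_Icc_succ_top (by omega)] at split
  rw [← aeval_E, show 2 * s + (m + 2) = 2 * (s + 1) + m by ring,
    show 2 * x - 2 * s - 2 = 2 * x - 2 * (s + 1 : ℕ) by push_cast; ring, split]
  simp only [map_mul, map_sub, aeval_X, map_natCast, map_ofNat]
  push_cast
  ring

theorem exists_pochhammer_factor_length (lam : List ℕ) :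
    ∃ T : ZHalf[X], ∀ x : ℚ,
      (ascPochhammer ℚ (2 * lam.sum + (lam.length + 1))).eval (2 * x - 2 * lam.sum - 2)
          * ∏ i ∈ Finset.Icc 1 lam.sum, (2 * x - 2 * i)
        = aeval x T * (∏ j ∈ Finset.Icc 1 (lam.length + 1 - 3), (2 * x + j))
          * ∏ i ∈ Finset.Icc 1 lam.sum, (2 * x - 2 * i + 1) := by
  rcases lam with _ | ⟨a, lam⟩
  · exact ⟨2 * Polynomial.X - 2, fun x => by simp [map_ofNat]⟩
  · exact exists_pochhammer_factor (a :: lam).sum lam.length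

theorem exists_pochhammer_form (lam : List ℕ) (Q : ZHalf[X]) :
    ∃ R : ZHalf[X], ∀ g : ℕ, lam.sum + 2 ≤ g →
      aeval (g : ℚ) Q / (∏ j ∈ Finset.Icc 1 (lam.length + 1 - 3), (2 * (g : ℚ) + j))
          * ∏ i ∈ Finset.Icc 1 lam.sum, (2 * (g : ℚ) - 2 * i) / (2 * (g : ℚ) - 2 * i + 1) ^ 3 =
        aeval (g : ℚ) R /
          ((ascPochhammer ℚ (2 * lam.sum + (lam.length + 1))).eval (2 * (g : ℚ) - 2 * lam.sum - 2)
            * ∏ i ∈ Finset.Icc 1 lam.sum, (2 * (g : ℚ) - 2 * i + 1) ^ 2) := by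
  obtain ⟨T, hT⟩ := exists_pochhammer_factor_length lam
  refine ⟨Q * T, fun g hg => ?_⟩
  have odd : ∏ i ∈ Finset.Icc 1 lam.sum, (2 * (g : ℚ) - 2 * i + 1) ≠ 0 := by
    refine Finset.prod_ne_zero_iff.mpr fun i hi => ?_
    have : (i : ℚ) ≤ g := Nat.cast_le.mpr ((Finset.mem_Icc.mp hi).2.trans (by omega))
    linarith
  have denominator : ∏ j ∈ Finset.Icc 1 (lam.length + 1 - 3), (2 * (g : ℚ) + j) ≠ 0 := by
    refine Finset.prod_ne_zero_iff.mpr fun j _ => ?_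
    have : 0 < g := by omega
    positivity
  have pochhammer : (ascPochhammer ℚ (2 * lam.sum + (lam.length + 1))).eval
      (2 * (g : ℚ) - 2 * lam.sum - 2) ≠ 0 := by
    have : (lam.sum + 2 : ℚ) ≤ g := by exact_mod_cast hg
    exact (ascPochhammer_pos _ _ (by linarith)).ne'
  rw [Finset.prod_div_distrib, Finset.prod_pow, Finset.prod_pow, map_mul, div_mul_div_comm,
    div_eq_div_iff (mul_ne_zero denominator (pow_ne_zero 3 odd))
      (mul_ne_zero pochhammer (pow_ne_zero 2 odd))]
  linear_combination aeval (g : ℚ) Q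
    * (∏ i ∈ Finset.Icc 1 lam.sum, (2 * (g : ℚ) - 2 * i + 1)) ^ 2 * hT g

theorem exists_aeval_two_mul_sub_two_add (P : ZHalf[X]) (n : ℕ) :
    ∃ Q : ZHalf[X], ∀ x : ℚ, aeval x Q = aeval (2 * x - 2 + n) P :=
  ⟨P.comp (2 * Polynomial.X - 2 + (n : ZHalf[X])), fun x => by simp [aeval_comp, map_ofNat]⟩

end Pochhammer

end BGW

theorem proposition4p3_general (n : ℕ) (lam : List ℕ) (hlen : lam.length + 1 = n) :
    ∃ P Q R : Polynomial BGW.ZHalf,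
      P.Monic ∧
      (2 ≤ n →
        P.natDegree + 2 = (lam.map fun a => 2 * a + 1).sum + (if n = 2 then 1 else 0) ∧
        ∀ d : ℕ,
          BGW.C (lam ++ [d]) =
            1 / ((BGW.X (lam ++ [d]) : ℚ) ^ (if n = 2 then 1 else 0)
                  * ((BGW.X (lam ++ [d]) - 1)! : ℚ))
              * (((2 * d + 1)‼ : ℚ) ^ 3 / (2 ^ (d + 1) * (d ! : ℚ)))
              * Polynomial.aeval (BGW.X (lam ++ [d]) : ℚ) P) ∧
      (∀ x : ℚ, Polynomial.aeval x Q = Polynomial.aeval (2 * x - 2 + n) P) ∧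
      (∀ g : ℕ, lam.sum + 1 ≤ g →
        BGW.C [g - 1] ≠ 0 ∧
        BGW.C (lam ++ [g - 1 - lam.sum]) / BGW.C [g - 1] =
          Polynomial.aeval (g : ℚ) Q / (∏ j ∈ Finset.Icc 1 (n - 3), (2 * (g : ℚ) + j))
            * ∏ i ∈ Finset.Icc 1 lam.sum,
                (2 * (g : ℚ) - 2 * i) / (2 * (g : ℚ) - 2 * i + 1) ^ 3) ∧
      (∀ g : ℕ, lam.sum + 2 ≤ g →
        BGW.C (lam ++ [g - 1 - lam.sum]) / BGW.C [g - 1] =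
          Polynomial.aeval (g : ℚ) R /
            ((ascPochhammer ℚ (2 * lam.sum + n)).eval (2 * (g : ℚ) - 2 * lam.sum - 2)
              * ∏ i ∈ Finset.Icc 1 lam.sum, (2 * (g : ℚ) - 2 * i + 1) ^ 2)) := by
  subst hlen
  obtain ⟨P, monic, formula, ratio⟩ := BGW.exists_monic_polynomial_ratio lam
  obtain ⟨Q, hQ⟩ := BGW.exists_aeval_two_mul_sub_two_add P (lam.length + 1)
  obtain ⟨R, hR⟩ := BGW.exists_pochhammer_form lam Q
  refine ⟨P, Q, R, monic, formula, hQ, fun g hg => ⟨BGW.C_singleton_ne_zero _, ?_⟩, fun g hg => ?_⟩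
  · rw [ratio g hg, hQ]
  · rw [ratio g (by omega), ← hR g hg, hQ]

theorem proposition4p3 (n : ℕ) (lam : List ℕ) (hlen : lam.length + 1 = n)
    (hpos : ∀ a ∈ lam, 1 ≤ a) :
    ∃ P Q R : Polynomial BGW.ZHalf,
      P.Monic ∧
      -- the formula for `C(λ, dₙ)` and the degree of `P`, for `n ≥ 2`
      (2 ≤ n →
        P.natDegree + 2 = (lam.map fun a => 2 * a + 1).sum + (if n = 2 then 1 else 0) ∧
        ∀ d : ℕ,
          BGW.C (lam ++ [d]) =
            1 / ((BGW.X (lam ++ [d]) : ℚ) ^ (if n = 2 then 1 else 0)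
                  * ((BGW.X (lam ++ [d]) - 1)! : ℚ))
              * (((2 * d + 1)‼ : ℚ) ^ 3 / (2 ^ (d + 1) * (d ! : ℚ)))
              * Polynomial.aeval (BGW.X (lam ++ [d]) : ℚ) P) ∧
      -- `C(λ, g-1-|λ|) / C(g-1)` as an explicit rational function of `g`
      (∀ x : ℚ, Polynomial.aeval x Q = Polynomial.aeval (2 * x - 2 + n) P) ∧
      (∀ g : ℕ, lam.sum + 1 ≤ g →
        BGW.C [g - 1] ≠ 0 ∧
        BGW.C (lam ++ [g - 1 - lam.sum]) / BGW.C [g - 1] =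
          Polynomial.aeval (g : ℚ) Q / (∏ j ∈ Finset.Icc 1 (n - 3), (2 * (g : ℚ) + j))
            * ∏ i ∈ Finset.Icc 1 lam.sum,
                (2 * (g : ℚ) - 2 * i) / (2 * (g : ℚ) - 2 * i + 1) ^ 3) ∧
      -- the form with Pochhammer denominator, which is nonzero for `g ≥ |λ| + 2`
      (∀ g : ℕ, lam.sum + 2 ≤ g →
        BGW.C (lam ++ [g - 1 - lam.sum]) / BGW.C [g - 1] =
          Polynomial.aeval (g : ℚ) R /
            ((ascPochhammer ℚ (2 * lam.sum + n)).eval (2 * (g : ℚ) - 2 * lam.sum - 2)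
              * ∏ i ∈ Finset.Icc 1 lam.sum, (2 * (g : ℚ) - 2 * i + 1) ^ 2)) :=
  proposition4p3_general n lam hlen
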